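/- Let $E$ be a locally compact Hausdorff space with a countable base, equipped with its Borel $\sigma$-algebra, and let $\Omega$ be the space of continuous trajectories $\omega:[0,\infty)\to E$, with the compact-open topology and the $\sigma$-algebra generated by the coordinate maps $X_t(\omega)=\omega(t)$, $t\ge 0$. Consider a diffusion on $E$, i.e. the following data. $(\hat P_t)_{t\ge0}$ is a strongly continuous semigroup of bounded linear operators on $C_0(E)$ with $\hat P_0=I$ such that $0\le f\le 1$ implies $0\le \hat P_tf\le1$; it is honest, i.e. the kernels $P_t(x,\mathrm dy)$ determined by $\hat P_tf(x)=\int f(y)\,P_t(x,\mathrm dy)$ for $f\in C_0(E)$ are Markov kernels (of total mass one). For every $x\in E$, $\mathbb P^x$ is a probability measure on $\Omega$ with $\mathbb P^x(X_0\in \mathrm dx_0,X_{t_1}\in \mathrm dx_1,\dots,X_{t_n}\in \mathrm dx_n)=\delta_x(\mathrm dx_0)P_{t_1}(x_0,\mathrm dx_1)\cdots P_{t_n-t_{n-1}}(x_{n-1},\mathrm dx_n)$ for all $n$ and $0<t_1<\dots<t_n$; and $\mathbb P^{x_n}\to\mathbb P^x$ weakly whenever $x_n\to x$ in $E$. Let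 $obs:E\to[0,1]$ be continuous and let $0<c<1$. For probability measures $\mu,\nu$ on the same space and a cost $k$ with values in $[0,1]$, put $W(k)(\mu,\nu)=\inf_\gamma\int k\,\mathrm d\gamma$, where $\gamma$ ranges over the couplings of $\mu$ and $\nu$. For $m:E\times E\to[0,1]$ put $$\mathcal F_c(m)(x,y)=\sup_{t\ge0}c^t\,W(m)(P_t(x,\cdot),P_t(y,\cdot)),\qquad U_c(m)(\omega,\omega')=\sup_{t\ge0}c^t\,m(\omega(t),\omega'(t)),\qquad \mathcal G_c(m)(x,y)=W(U_c(m))(\mathbb P^x,\mathbb P^y).$$ Set $\delta^c_0(x,y)=d^c_0(x,y)=|obs(x)-obs(y)|$ and, for $n\ge0$, $\delta^c_{n+1}=\mathcal F_c(\delta^c_n)$ and $d^c_{n+1}=\mathcal G_c(d^c_n)$. Let $\overline\delta^c=\sup_n\delta^c_n$ (the kernel-based pseudometric) and $\overline d^c=\sup_n d^c_n$ (the trajectory-based pseudometric). Let $\Lambda$ be the set of expressions $$f::=q\mid obs\mid\min\{f_1,f_2\}\mid 1-f\mid f\ominus q\mid\langle t\rangle f,$$ and let $\mathcal L_\sigma$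 and $\mathcal L_\tau$ be the sets of expressions generated by the mutual recursion $$f\in\mathcal L_\sigma::=q\mid obs\mid 1-f\mid\textstyle\int g,\qquad g\in\mathcal L_\tau::=f\circ ev_t\mid\min\{g_1,g_2\}\mid\max\{g_1,g_2\}\mid g\ominus q\mid g\oplus q,$$ with $q\in\mathbb Q\cap[0,1]$ and $t\in\mathbb Q_{\ge0}$. The expressions of $\Lambda$ and $\mathcal L_\sigma$ are interpreted as functions on $E$, those of $\mathcal L_\tau$ as functions on $\Omega$: constants, $obs$, $1-f$, $\min$ and $\max$ have their usual (pointwise) meaning, $f\ominus q=\max\{0,f-q\}$, $g\oplus q=\min\{1,g+q\}$, $(\langle t\rangle f)(x)=c^t\int f(y)\,P_t(x,\mathrm dy)$, $(\int g)(x)=\int g\,\mathrm d\mathbb P^x$ and $(f\circ ev_t)(\omega)=c^tf(\omega(t))$. Put $$\lambda^c(x,y)=\sup_{f\in\Lambda}|f(x)-f(y)|,\qquad \ell^c(x,y)=\sup_{f\in\mathcal L_\sigma}|f(x)-f(y)|.$$ Theorem. For every $0<c<1$, $$\lambda^c=\overline\delta^c\le\overline d^c=\ell^c$$ as functions on $E\times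 E$. -/

import Mathlib

open MeasureTheory ProbabilityTheory Filter Topology
open scoped NNReal ENNReal ZeroAtInfty BoundedContinuousFunction

namespace FellerDynkin

/-! ### Optimal transport -/

section Transport

variable {X : Type*} [MeasurableSpace X]

/-- The set `Γ(μ, ν)` of couplings of `μ` and `ν`. -/
def couplings (μ ν : Measure X) : Set (Measure (X × X)) :=
  {γ | IsProbabilityMeasure γ ∧ γ.map Prod.fst = μ ∧ γ.map Prod.snd = ν}

/-- The optimal transport cost `W(k)(μ, ν) = inf_{γ ∈ Γ(μ, ν)} ∫ k dγ` for a cost function `k`.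
Costs and pseudometrics are functions with values in `[0, ∞]` throughout; those that occur below
take their values in `[0, 1]`. -/
noncomputable def transport (k : X → X → ℝ≥0∞) (μ ν : Measure X) : ℝ≥0∞ :=
  ⨅ γ ∈ couplings μ ν, ∫⁻ p, k p.1 p.2 ∂γ

end Transport

/-! ### Feller-Dynkin semigroups and diffusions -/

/-- A Feller-Dynkin semigroup on `C₀(E)`. -/
structure FDSemigroup (E : Type*) [TopologicalSpace E] where
  op : ℝ≥0 → C₀(E, ℝ) →L[ℝ] C₀(E, ℝ)
  op_comp : ∀ s t, (op s).comp (op t) = op (s + t)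
  op_zero : op 0 = ContinuousLinearMap.id ℝ C₀(E, ℝ)
  strongly_continuous : ∀ f : C₀(E, ℝ), Tendsto (fun t => ‖op t f - f‖) (𝓝[>] 0) (𝓝 0)
  sub_markov : ∀ (t : ℝ≥0) (f : C₀(E, ℝ)), (∀ x, 0 ≤ f x ∧ f x ≤ 1) →
    ∀ x, 0 ≤ op t f x ∧ op t f x ≤ 1

/-- The space `Ω` of continuous trajectories `[0, ∞) → E`. Its topology is the compact-open
topology (uniform convergence on compact time intervals). -/
abbrev Trajectory (E : Type*) [TopologicalSpace E] := C(ℝ≥0, E)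

/-- The `σ`-algebra `𝒜 = σ(X_s | s ≥ 0)` generated by the coordinates `X_s(ω) = ω(s)`. -/
instance Trajectory.instMeasurableSpace (E : Type*) [TopologicalSpace E] [MeasurableSpace E] :
    MeasurableSpace (Trajectory E) :=
  ⨆ s : ℝ≥0, MeasurableSpace.comap (fun ω : Trajectory E => ω s) inferInstance

section CylinderLaw

variable {E : Type*} [TopologicalSpace E] [MeasurableSpace E]

/-- For a list `(t₁, C₁), …, (tₙ, Cₙ)` with `s < t₁ < ⋯ < tₙ`, the iterated integral
`∫_{C₁} P_{t₁ - s}(x, dx₁) ∫_{C₂} P_{t₂ - t₁}(x₁, dx₂) ⋯ ∫_{Cₙ} P_{tₙ - tₙ₋₁}(xₙ₋₁, dxₙ)`. -/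
noncomputable def cylinderProb (P : ℝ≥0 → Kernel E E) : ℝ≥0 → List (ℝ≥0 × Set E) → E → ℝ≥0∞
  | _, [], _ => 1
  | s, (t, C) :: l, x => ∫⁻ y in C, cylinderProb P t l y ∂(P (t - s) x)

end CylinderLaw

/-- A diffusion: an honest Feller-Dynkin semigroup `(P̂_t)` together with the (unique) Markov
kernels `(P_t)` that represent it and the (unique) laws `ℙ^x` of the associated canonical process,
which live on the continuous trajectories and depend weakly continuously on `x`. -/
structure Diffusion (E : Type*) [TopologicalSpace E] [MeasurableSpace E]
    extends FDSemigroup E where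
  kernel : ℝ≥0 → Kernel E E
  /-- honesty: no loss of mass -/
  honest : ∀ t, IsMarkovKernel (kernel t)
  op_eq_integral : ∀ (t : ℝ≥0) (f : C₀(E, ℝ)) (x : E), op t f x = ∫ y, f y ∂(kernel t x)
  law : E → Measure (Trajectory E)
  law_prob : ∀ x, IsProbabilityMeasure (law x)
  /-- finite dimensional distributions, at the times `0 < t₁ < ⋯ < tₙ` -/
  law_cylinder : ∀ (x : E) (A : Set E) (l : List (ℝ≥0 × Set E)),
    MeasurableSet A → (∀ p ∈ l, MeasurableSet p.2) →
    (0 :: l.map Prod.fst).Pairwise (· < ·) →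
    law x {ω | ω 0 ∈ A ∧ ∀ p ∈ l, ω p.1 ∈ p.2} =
      ∫⁻ x₀ in A, cylinderProb kernel 0 l x₀ ∂(Measure.dirac x)
  /-- weak continuity of `x ↦ ℙ^x` -/
  law_continuous : ∀ (u : ℕ → E) (x : E), Tendsto u atTop (𝓝 x) → ∀ f : Trajectory E →ᵇ ℝ,
    Tendsto (fun n => ∫ ω, f ω ∂(law (u n))) atTop (𝓝 (∫ ω, f ω ∂(law x)))

/-! ### The two functionals and their iterates -/

section Pseudometrics

variable {E : Type*} [TopologicalSpace E] [MeasurableSpace E]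

/-- The pseudometric `(x, y) ↦ |obs(x) - obs(y)|`. -/
noncomputable def obsDist (obs : C(E, unitInterval)) (x y : E) : ℝ≥0∞ :=
  ENNReal.ofReal |(obs x : ℝ) - obs y|

/-- `𝓕_c(m)(x, y) = sup_{t ≥ 0} c^t W(m)(P_t(x), P_t(y))`. -/
noncomputable def kernelFunctional (D : Diffusion E) (c : ℝ) (m : E → E → ℝ≥0∞) (x y : E) : ℝ≥0∞ :=
  ⨆ t : ℝ≥0, ENNReal.ofReal (c ^ (t : ℝ)) * transport m (D.kernel t x) (D.kernel t y)

/-- The sequence `δ^c_0 = |obs - obs|`, `δ^c_{n+1} = 𝓕_c(δ^c_n)`. -/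
noncomputable def deltaSeq (D : Diffusion E) (obs : C(E, unitInterval)) (c : ℝ) :
    ℕ → E → E → ℝ≥0∞
  | 0 => obsDist obs
  | n + 1 => kernelFunctional D c (deltaSeq D obs c n)

/-- The kernel-based pseudometric `δ̄^c = sup_n δ^c_n`. -/
noncomputable def deltaBar (D : Diffusion E) (obs : C(E, unitInterval)) (c : ℝ) (x y : E) : ℝ≥0∞ :=
  ⨆ n, deltaSeq D obs c n x y

/-- The discounted uniform pseudometric `U_c(m)(ω, ω') = sup_{t ≥ 0} c^t m(ω(t), ω'(t))`. -/
noncomputable def discountedUniform (c : ℝ) (m : E → E → ℝ≥0∞) (ω ω' : Trajectory E) : ℝ≥0∞ :=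
  ⨆ t : ℝ≥0, ENNReal.ofReal (c ^ (t : ℝ)) * m (ω t) (ω' t)

/-- `𝓖_c(m)(x, y) = W(U_c(m))(ℙ^x, ℙ^y)`. -/
noncomputable def trajFunctional (D : Diffusion E) (c : ℝ) (m : E → E → ℝ≥0∞) (x y : E) : ℝ≥0∞ :=
  transport (discountedUniform c m) (D.law x) (D.law y)

/-- The sequence `d^c_0 = |obs - obs|`, `d^c_{n+1} = 𝓖_c(d^c_n)`. -/
noncomputable def dSeq (D : Diffusion E) (obs : C(E, unitInterval)) (c : ℝ) : ℕ → E → E → ℝ≥0∞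
  | 0 => obsDist obs
  | n + 1 => trajFunctional D c (dSeq D obs c n)

/-- The trajectory-based pseudometric `d̄^c = sup_n d^c_n`. -/
noncomputable def dBar (D : Diffusion E) (obs : C(E, unitInterval)) (c : ℝ) (x y : E) : ℝ≥0∞ :=
  ⨆ n, dSeq D obs c n x y

end Pseudometrics

/-! ### The two real-valued logics -/

/-- The expressions of the logic `Λ`. -/
inductive KernelFormula : Type
  | const (q : Set.Icc (0 : ℚ) 1)
  | obs
  | min (f₁ f₂ : KernelFormula)
  | compl (f : KernelFormula)
  | tsub (f : KernelFormula) (q : Set.Icc (0 : ℚ) 1)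
  | diamond (t : ℚ≥0) (f : KernelFormula)

mutual

/-- The expressions of the logic `𝓛_σ`. -/
inductive StateFormula : Type
  | const (q : Set.Icc (0 : ℚ) 1)
  | obs
  | compl (f : StateFormula)
  | integral (g : TrajFormula)

/-- The expressions of the logic `𝓛_τ`. -/
inductive TrajFormula : Type
  | ev (f : StateFormula) (t : ℚ≥0)
  | min (g₁ g₂ : TrajFormula)
  | max (g₁ g₂ : TrajFormula)
  | tsub (g : TrajFormula) (q : Set.Icc (0 : ℚ) 1)
  | tadd (g : TrajFormula) (q : Set.Icc (0 : ℚ) 1)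

end

section Logics

variable {E : Type*} [TopologicalSpace E] [MeasurableSpace E]

/-- The interpretation of the expressions of `Λ` as functions on the state space. -/
noncomputable def KernelFormula.eval (D : Diffusion E) (o : C(E, unitInterval)) (c : ℝ) :
    KernelFormula → E → ℝ
  | .const q, _ => ((q : ℚ) : ℝ)
  | .obs, x => o x
  | .min f₁ f₂, x => Min.min (f₁.eval D o c x) (f₂.eval D o c x)
  | .compl f, x => 1 - f.eval D o c x
  | .tsub f q, x => Max.max 0 (f.eval D o c x - ((q : ℚ) : ℝ))
  | .diamond t f, x => c ^ (t : ℝ) * ∫ y, f.eval D o c y ∂(D.kernel (t : ℝ≥0) x)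

mutual

/-- The interpretation of the expressions of `𝓛_σ` as functions on the state space. -/
noncomputable def StateFormula.eval (D : Diffusion E) (o : C(E, unitInterval)) (c : ℝ) :
    StateFormula → E → ℝ
  | .const q, _ => ((q : ℚ) : ℝ)
  | .obs, x => o x
  | .compl f, x => 1 - f.eval D o c x
  | .integral g, x => ∫ ω, g.eval D o c ω ∂(D.law x)

/-- The interpretation of the expressions of `𝓛_τ` as functions on the trajectory space. -/
noncomputable def TrajFormula.eval (D : Diffusion E) (o : C(E, unitInterval)) (c : ℝ) :
    TrajFormula → Trajectory E → ℝ
  | .ev f t, ω => c ^ (t : ℝ) * f.eval D o c (ω (t : ℝ≥0))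
  | .min g₁ g₂, ω => Min.min (g₁.eval D o c ω) (g₂.eval D o c ω)
  | .max g₁ g₂, ω => Max.max (g₁.eval D o c ω) (g₂.eval D o c ω)
  | .tsub g q, ω => Max.max 0 (g.eval D o c ω - ((q : ℚ) : ℝ))
  | .tadd g q, ω => Min.min 1 (g.eval D o c ω + ((q : ℚ) : ℝ))

end

/-- The logical pseudometric `λ^c(x, y) = sup_{f ∈ Λ_c} |f(x) - f(y)|`. -/
noncomputable def lambdaDist (D : Diffusion E) (obs : C(E, unitInterval)) (c : ℝ) (x y : E) :
    ℝ≥0∞ :=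
  ⨆ f : KernelFormula, ENNReal.ofReal |f.eval D obs c x - f.eval D obs c y|

/-- The logical pseudometric `ℓ^c(x, y) = sup_{f ∈ 𝓛_σ^c} |f(x) - f(y)|`. -/
noncomputable def ellDist (D : Diffusion E) (obs : C(E, unitInterval)) (c : ℝ) (x y : E) :
    ℝ≥0∞ :=
  ⨆ f : StateFormula, ENNReal.ofReal |f.eval D obs c x - f.eval D obs c y|

end Logics

end FellerDynkin

open FellerDynkin

/-!
By induction, every formula of `Λ` is non-expansive for some `δ_n` and every formula of `𝓛_σ` for
some `d_n`, which gives `λ ≤ δ̄` and `ℓ ≤ d̄`. For the converse inequalities it suffices that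
`𝓕_c(λ) ≤ λ` and `𝓖_c(ℓ) ≤ ℓ`. By Kantorovich duality the transport cost for `sup_i |g_i - g_i|`
is a supremum of `|∫ h dμ - ∫ h dν|` over `1`-Lipschitz potentials `h` of finitely many `g_i`, and
when the `g_i` are the formulas, a Stone-Weierstrass argument approximates each such `h` uniformly
by formulas, up to an additive constant. This reduces the cost to `sup_i |∫ g_i dμ - ∫ g_i dν|`,
and the integral of a formula is again a formula. Both spaces are standard Borel; embedding them
into a compact space on which the countably many formulas are continuous reduces the duality to
the compact case. Finally, `δ̄ ≤ d̄` because evaluation at time `t` maps couplings of `ℙ^x` and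
`ℙ^y` to couplings of `P_t(x)` and `P_t(y)`.
-/

namespace FellerDynkin

section UniformClosure

variable {X ι : Type*}

theorem exists_rat_mem_Icc_abs_sub_le {a ε : ℝ} (ha : a ∈ Set.Icc (0 : ℝ) 1) (hε : 0 < ε) :
    ∃ q : Set.Icc (0 : ℚ) 1, |((q : ℚ) : ℝ) - a| ≤ ε := by
  obtain ⟨q, hq⟩ := exists_rat_near a hε
  refine ⟨Set.projIcc 0 1 zero_le_one q, ?_⟩
  calc |((Set.projIcc 0 1 zero_le_one q : ℚ) : ℝ) - a|
      = |(Set.projIcc (0 : ℝ) 1 zero_le_one q : ℝ) - Set.projIcc (0 : ℝ) 1 zero_le_one a| := by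
        rw [Set.projIcc_of_mem _ ha]
        simp only [Set.coe_projIcc, Rat.cast_max, Rat.cast_min, Rat.cast_zero, Rat.cast_one]
    _ ≤ |(q : ℝ) - a| := Set.abs_projIcc_sub_projIcc zero_le_one
    _ ≤ ε := by rw [abs_sub_comm]; exact hq.le

/-- The closure of a family of real functions under uniform limits, spelled out with `ε` so that
no topology on the space of all real functions is needed. -/
def uniformClosure (g : ι → X → ℝ) : Set (X → ℝ) :=
  {h | ∀ ε > 0, ∃ i, ∀ x, |g i x - h x| ≤ ε}

theorem self_mem_uniformClosure (g : ι → X → ℝ) (i : ι) : g i ∈ uniformClosure g :=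
  fun ε hε => ⟨i, fun x => by simpa only [sub_self, abs_zero] using hε.le⟩

theorem mem_uniformClosure_of_approx {g : ι → X → ℝ} {h : X → ℝ}
    (happrox : ∀ ε > 0, ∃ k ∈ uniformClosure g, ∀ x, |k x - h x| ≤ ε) : h ∈ uniformClosure g := by
  intro ε hε
  obtain ⟨k, hk, hkh⟩ := happrox (ε / 2) (half_pos hε)
  obtain ⟨i, hik⟩ := hk (ε / 2) (half_pos hε)
  exact ⟨i, fun x => by linarith [abs_sub_le (g i x) (k x) (h x), hik x, hkh x]⟩

/-- A family of `[0, 1]`-valued functions whose uniform closure is stable under minima, under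
`f ↦ 1 - f` and under truncated subtraction of rational constants. Both logics provide such
families, and only closure up to uniform approximation is asked for because `𝓛_τ` has no
complement. -/
structure IsApproxLattice (g : ι → X → ℝ) : Prop where
  mem_Icc : ∀ i x, g i x ∈ Set.Icc (0 : ℝ) 1
  inf_mem : ∀ i j, (fun x => min (g i x) (g j x)) ∈ uniformClosure g
  compl_mem : ∀ i, (fun x => 1 - g i x) ∈ uniformClosure g
  tsub_mem : ∀ i (q : Set.Icc (0 : ℚ) 1),
    (fun x => max 0 (g i x - ((q : ℚ) : ℝ))) ∈ uniformClosure g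

namespace IsApproxLattice

variable {g : ι → X → ℝ} {h k : X → ℝ} (H : IsApproxLattice g)

include H

theorem mem_Icc_of_mem (hh : h ∈ uniformClosure g) (x : X) : h x ∈ Set.Icc (0 : ℝ) 1 := by
  constructor <;> refine le_of_forall_pos_le_add fun ε hε => ?_ <;>
    obtain ⟨i, hi⟩ := hh ε hε <;>
    linarith [abs_le.1 (hi x), (H.mem_Icc i x).1, (H.mem_Icc i x).2]

theorem compl (hh : h ∈ uniformClosure g) : (fun x => 1 - h x) ∈ uniformClosure g := by
  refine mem_uniformClosure_of_approx fun ε hε => ?_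
  obtain ⟨i, hi⟩ := hh ε hε
  refine ⟨_, H.compl_mem i, fun x => ?_⟩
  rw [sub_sub_sub_cancel_left, abs_sub_comm]
  exact hi x

theorem inf (hh : h ∈ uniformClosure g) (hk : k ∈ uniformClosure g) :
    (fun x => min (h x) (k x)) ∈ uniformClosure g := by
  refine mem_uniformClosure_of_approx fun ε hε => ?_
  obtain ⟨i, hi⟩ := hh ε hε
  obtain ⟨j, hj⟩ := hk ε hε
  exact ⟨_, H.inf_mem i j, fun x =>
    (abs_min_sub_min_le_max _ _ _ _).trans (max_le (hi x) (hj x))⟩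

theorem sup (hh : h ∈ uniformClosure g) (hk : k ∈ uniformClosure g) :
    (fun x => max (h x) (k x)) ∈ uniformClosure g := by
  convert H.compl (H.inf (H.compl hh) (H.compl hk)) using 2 with x
  grind

theorem tsub (hh : h ∈ uniformClosure g) {a : ℝ} (ha : a ∈ Set.Icc (0 : ℝ) 1) :
    (fun x => max 0 (h x - a)) ∈ uniformClosure g := by
  refine mem_uniformClosure_of_approx fun ε hε => ?_
  obtain ⟨i, hi⟩ := hh (ε / 2) (half_pos hε)
  obtain ⟨q, hq⟩ := exists_rat_mem_Icc_abs_sub_le ha (half_pos hε)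
  refine ⟨_, H.tsub_mem i q, fun x => ?_⟩
  refine (abs_max_sub_max_le_max _ _ _ _).trans (max_le (by simpa using hε.le) ?_)
  rw [sub_sub_sub_comm]
  linarith [abs_sub (g i x - h x) ((q : ℚ) - a), hi x]

theorem clamp_add (hh : h ∈ uniformClosure g) {a : ℝ} (ha : |a| ≤ 1) :
    (fun x => max 0 (min 1 (h x + a))) ∈ uniformClosure g := by
  obtain ⟨ha₁, ha₂⟩ := abs_le.1 ha
  have h_nonneg := fun x => (H.mem_Icc_of_mem hh x).1
  have h_le_one := fun x => (H.mem_Icc_of_mem hh x).2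
  rcases le_total a 0 with h0 | h0
  · convert H.tsub hh (a := -a) ⟨by linarith, by linarith⟩ using 2 with x
    grind
  · convert H.compl (H.tsub (H.compl hh) (a := a) ⟨h0, ha₂⟩) using 2 with x
    grind

theorem const_mem [Nonempty ι] {r : ℝ} (hr : r ∈ Set.Icc (0 : ℝ) 1) :
    (fun _ : X => r) ∈ uniformClosure g := by
  obtain ⟨i⟩ := ‹Nonempty ι›
  have h_one : (fun _ : X => (1 : ℝ)) ∈ uniformClosure g := by
    convert H.clamp_add (self_mem_uniformClosure g i) (a := 1) (by simp) using 2 with x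
    grind [(H.mem_Icc i x).1]
  convert H.tsub h_one (a := 1 - r) ⟨sub_nonneg.2 hr.2, by linarith [hr.1]⟩ using 2
  rw [sub_sub_cancel, max_eq_right hr.1]

theorem abs_sub_le_one (i : ι) (x y : X) : |g i x - g i y| ≤ 1 :=
  Real.dist_le_of_mem_Icc_01 (H.mem_Icc i x) (H.mem_Icc i y)

theorem tent_mem {a r : ℝ} (ha : a ∈ Set.Icc (0 : ℝ) 1) (hr : r ∈ Set.Icc (0 : ℝ) 1) (i : ι) :
    (fun y => max 0 (r - |a - g i y|)) ∈ uniformClosure g := by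
  have h_up := H.clamp_add (self_mem_uniformClosure g i) (a := r - a)
    (abs_sub_le_iff.2 ⟨by linarith [hr.2, ha.1], by linarith [hr.1, ha.2]⟩)
  have h_down := H.clamp_add (H.compl (self_mem_uniformClosure g i)) (a := r + a - 1)
    (abs_le.2 ⟨by linarith [hr.1, ha.1], by linarith [hr.2, ha.2]⟩)
  convert H.inf h_up h_down using 2 with y
  grind [hr.1, hr.2]

end IsApproxLattice

/-- The pseudometric `sup_{i ∈ S} |gᵢ(x) - gᵢ(y)|`, as the sup distance in `S → ℝ`. -/
noncomputable def finDist (g : ι → X → ℝ) (S : Finset ι) (x y : X) : ℝ :=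
  dist (fun i : S => g i x) (fun i : S => g i y)

variable {g : ι → X → ℝ} {S T : Finset ι} {x y : X}

theorem finDist_nonneg : 0 ≤ finDist g S x y :=
  dist_nonneg

theorem finDist_le_iff {r : ℝ} (hr : 0 ≤ r) :
    finDist g S x y ≤ r ↔ ∀ i ∈ S, |g i x - g i y| ≤ r := by
  simp [finDist, dist_pi_le_iff hr, Real.dist_eq]

theorem abs_sub_le_finDist {i : ι} (hi : i ∈ S) : |g i x - g i y| ≤ finDist g S x y :=
  (finDist_le_iff finDist_nonneg).1 le_rfl i hi

theorem finDist_mono (h : S ⊆ T) : finDist g S x y ≤ finDist g T x y :=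
  (finDist_le_iff finDist_nonneg).2 fun _ hi => abs_sub_le_finDist (h hi)

theorem finDist_empty : finDist g ∅ x y = 0 :=
  le_antisymm ((finDist_le_iff le_rfl).2 (by simp)) finDist_nonneg

theorem finDist_insert [DecidableEq ι] (i : ι) :
    finDist g (insert i S) x y = max |g i x - g i y| (finDist g S x y) := by
  refine le_antisymm ((finDist_le_iff (le_max_of_le_right finDist_nonneg)).2 fun j hj => ?_)
    (max_le (abs_sub_le_finDist (S.mem_insert_self i)) (finDist_mono (S.subset_insert i)))
  rcases Finset.mem_insert.1 hj with rfl | hj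
  · exact le_max_left _ _
  · exact le_max_of_le_right (abs_sub_le_finDist hj)

namespace IsApproxLattice

variable {h : X → ℝ} (H : IsApproxLattice g)

include H

theorem finDist_le_one : finDist g S x y ≤ 1 :=
  (finDist_le_iff zero_le_one).2 fun i _ => H.abs_sub_le_one i x y

theorem finDist_tent_mem [Nonempty ι] (x : X) {r : ℝ} (hr : r ∈ Set.Icc (0 : ℝ) 1)
    (S : Finset ι) : (fun y => max 0 (r - finDist g S x y)) ∈ uniformClosure g := by
  classical
  induction S using Finset.induction_on with
  | empty => simpa only [finDist_empty, sub_zero, max_eq_right hr.1] using H.const_mem hr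
  | insert i S _ ih =>
    convert H.inf (H.tent_mem (H.mem_Icc i x) hr i) ih using 2 with y
    rw [finDist_insert, ← max_min_distrib_left, min_sub_sub_left]

theorem exists_finite_net (S : Finset ι) {ε : ℝ} (hε : 0 < ε) :
    ∃ t : Finset X, ∀ y, ∃ x ∈ t, finDist g S x y ≤ ε := by
  classical
  let G : X → S → ℝ := fun x i => g i x
  have hG : TotallyBounded (Set.range G) := by
    refine (isCompact_univ_pi fun _ : S =>
      isCompact_Icc (a := (0 : ℝ)) (b := 1)).totallyBounded.subset ?_
    rintro _ ⟨x, rfl⟩ i -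
    exact H.mem_Icc i x
  obtain ⟨u, hu_sub, hu_fin, hu_cover⟩ := Metric.finite_approx_of_totallyBounded hG ε hε
  lift u to Finset (S → ℝ) using hu_fin
  rw [← Set.image_univ, Finset.subset_set_image_iff] at hu_sub
  obtain ⟨t, -, rfl⟩ := hu_sub
  refine ⟨t, fun y => ?_⟩
  obtain ⟨p, hp, hyp⟩ := Set.mem_iUnion₂.1 (hu_cover ⟨y, rfl⟩)
  obtain ⟨x, hx, rfl⟩ := Finset.mem_image.1 hp
  exact ⟨x, hx, (Metric.mem_ball'.1 hyp).le⟩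

/-- A Stone-Weierstrass argument: a Lipschitz function is the supremum of the tents below its
graph, and finitely many of these suffice up to `ε`. -/
theorem mem_of_abs_sub_le_finDist [Nonempty ι] [Nonempty X]
    (h_mem : ∀ x, h x ∈ Set.Icc (0 : ℝ) 1) (h_lip : ∀ x y, |h x - h y| ≤ finDist g S x y) :
    h ∈ uniformClosure g := by
  refine mem_uniformClosure_of_approx fun ε hε => ?_
  obtain ⟨t, ht⟩ := H.exists_finite_net S (half_pos hε)
  have ht_ne : t.Nonempty := (ht (Classical.arbitrary X)).imp fun _ hx => hx.1
  refine ⟨t.sup' ht_ne fun x y => max 0 (h x - finDist g S x y),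
    Finset.sup'_mem _ (fun _ ha _ hb => H.sup ha hb) _ ht_ne _
      fun x _ => H.finDist_tent_mem x (h_mem x) S, fun y => ?_⟩
  rw [Finset.sup'_apply, abs_sub_le_iff]
  constructor
  · have tent_le (x : X) : max 0 (h x - finDist g S x y) ≤ h y :=
      max_le (h_mem y).1 (by linarith [(abs_le.1 (h_lip x y)).2])
    linarith [Finset.sup'_le ht_ne _ fun x _ => tent_le x]
  · obtain ⟨x, hx, hxy⟩ := ht y
    have le_sup := Finset.le_sup' (fun x => max 0 (h x - finDist g S x y)) hx
    linarith [le_max_right 0 (h x - finDist g S x y), (abs_le.1 (h_lip x y)).1]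

theorem exists_sub_const_mem [Nonempty ι] [Nonempty X]
    (h_lip : ∀ x y, |h x - h y| ≤ finDist g S x y) :
    ∃ b : ℝ, (fun x => h x - b) ∈ uniformClosure g := by
  have h_osc (x y : X) : h x - 1 ≤ h y := by
    linarith [(abs_le.1 (h_lip x y)).2, H.finDist_le_one (S := S) (x := x) (y := y)]
  have h_bdd : BddBelow (Set.range h) :=
    ⟨h (Classical.arbitrary X) - 1, Set.forall_mem_range.2 fun y => h_osc _ y⟩
  refine ⟨⨅ y, h y, H.mem_of_abs_sub_le_finDist (S := S) (fun x => ⟨?_, ?_⟩) fun x y => ?_⟩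
  · exact sub_nonneg.2 (ciInf_le h_bdd x)
  · exact sub_le_comm.1 (le_ciInf (h_osc x))
  · rw [sub_sub_sub_cancel_right]
    exact h_lip x y

end IsApproxLattice

end UniformClosure

section CompactDuality

variable {K J : Type*} [TopologicalSpace K]

/-- The linear map `(φ, ψ) ↦ φ ⊕ ψ` with `(φ ⊕ ψ)(x, y) = φ x + ψ y`. A measure on `K × K` is a
coupling of `μ` and `ν` iff it integrates `φ ⊕ ψ` to `∫ φ dμ + ∫ ψ dν`. -/
def marginalSum : C(K, ℝ) × C(K, ℝ) →ₗ[ℝ] C(K × K, ℝ) :=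
  LinearMap.coprod (ContinuousMap.compRightAlgHom ℝ ℝ ⟨Prod.fst, continuous_fst⟩).toLinearMap
    (ContinuousMap.compRightAlgHom ℝ ℝ ⟨Prod.snd, continuous_snd⟩).toLinearMap

@[simp]
theorem marginalSum_apply (φ ψ : C(K, ℝ)) (p : K × K) :
    marginalSum (φ, ψ) p = φ p.1 + ψ p.2 := by
  simp [marginalSum]

/-- The functions that dominate a nonnegative multiple of `s - m j` for some `j`. A functional that
is positive on this cone is a positive measure for which every `m j` has mean at most `s`. -/
def dominationCone [Nonempty J] (m : J → C(K, ℝ)) (hm : Directed (· ≤ ·) m) (s : ℝ) :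
    PointedCone ℝ C(K, ℝ) where
  carrier := {u | ∃ a : ℝ, 0 ≤ a ∧ ∃ j, ∀ p, a * (s - m j p) ≤ u p}
  zero_mem' := ⟨0, le_rfl, Classical.arbitrary J, by simp⟩
  add_mem' := by
    rintro u v ⟨a, ha, i, hu⟩ ⟨b, hb, j, hv⟩
    obtain ⟨k, hik, hjk⟩ := hm i j
    refine ⟨a + b, add_nonneg ha hb, k, fun p => ?_⟩
    rw [ContinuousMap.add_apply]
    have h_left := mul_le_mul_of_nonneg_left (ContinuousMap.le_def.1 hik p) ha
    have h_right := mul_le_mul_of_nonneg_left (ContinuousMap.le_def.1 hjk p) hb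
    linarith [hu p, hv p]
  smul_mem' := by
    rintro ⟨r, hr⟩ u ⟨a, ha, j, hu⟩
    refine ⟨r * a, mul_nonneg hr ha, j, fun p => ?_⟩
    rw [mul_assoc]
    exact mul_le_mul_of_nonneg_left (hu p) hr

section Cone

variable [Nonempty J] {m : J → C(K, ℝ)} {hm : Directed (· ≤ ·) m} {s : ℝ}

theorem mem_dominationCone_of_nonneg {u : C(K, ℝ)} (hu : 0 ≤ u) : u ∈ dominationCone m hm s :=
  ⟨0, le_rfl, Classical.arbitrary J, fun p => by simpa using hu p⟩

theorem const_sub_mem_dominationCone (j : J) :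
    ContinuousMap.const K s - m j ∈ dominationCone m hm s :=
  ⟨1, zero_le_one, j, fun p => by simp⟩

end Cone

variable [CompactSpace K] [MeasurableSpace K]

theorem integrable_continuousMap [OpensMeasurableSpace K] (u : C(K, ℝ)) (ρ : Measure K)
    [IsFiniteMeasure ρ] : Integrable u ρ :=
  u.continuous.integrable_of_hasCompactSupport (.of_compactSpace u)

theorem exists_measure_integral_eq [T2Space K] [BorelSpace K] (L : C(K, ℝ) →ₗ[ℝ] ℝ)
    (hL : ∀ u, 0 ≤ u → 0 ≤ L u) :
    ∃ π : Measure K, IsFiniteMeasure π ∧ ∀ u : C(K, ℝ), ∫ x, u x ∂π = L u := by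
  let Λ : CompactlySupportedContinuousMap K ℝ →ₚ[ℝ] ℝ := PositiveLinearMap.mk₀
    { toFun := fun u => L u.toContinuousMap
      map_add' := fun u v => L.map_add u.toContinuousMap v.toContinuousMap
      map_smul' := fun a u => L.map_smul a u.toContinuousMap }
    fun u hu => hL _ hu
  exact ⟨RealRMK.rieszMeasure Λ, inferInstance, fun u =>
    RealRMK.integral_rieszMeasure Λ ⟨u, .of_compactSpace _⟩⟩

/-- Integration against a finite measure, as a linear functional on `C(K, ℝ)`. -/
noncomputable def integralLinearMap [OpensMeasurableSpace K] (ρ : Measure K) [IsFiniteMeasure ρ] :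
    C(K, ℝ) →ₗ[ℝ] ℝ where
  toFun u := ∫ x, u x ∂ρ
  map_add' u v := integral_add (integrable_continuousMap u ρ) (integrable_continuousMap v ρ)
  map_smul' a u := integral_const_mul a u

variable {μ ν : Measure K} [IsProbabilityMeasure μ] [IsProbabilityMeasure ν]

theorem integral_prod_marginalSum [OpensMeasurableSpace K] (φ ψ : C(K, ℝ)) :
    ∫ p, marginalSum (φ, ψ) p ∂(μ.prod ν) = ∫ x, φ x ∂μ + ∫ x, ψ x ∂ν := by
  simp only [marginalSum_apply]
  rw [integral_add ((integrable_continuousMap φ μ).comp_fst ν)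
      ((integrable_continuousMap ψ ν).comp_snd μ),
    integral_fun_fst (μ := μ) (ν := ν) φ, integral_fun_snd (μ := μ) (ν := ν) ψ]
  simp only [probReal_univ, one_smul]

theorem mem_couplings_of_integral_marginalSum [T2Space K] [SecondCountableTopology K]
    [BorelSpace K] {π : Measure (K × K)} [IsFiniteMeasure π]
    (hπ : ∀ φ ψ : C(K, ℝ), ∫ p, marginalSum (φ, ψ) p ∂π = ∫ x, φ x ∂μ + ∫ x, ψ x ∂ν) :
    π ∈ couplings μ ν := by
  have h_fst : π.map Prod.fst = μ := by
    refine ext_of_forall_integral_eq_of_IsFiniteMeasure fun φ => ?_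
    rw [integral_map measurable_fst.aemeasurable φ.continuous.aestronglyMeasurable]
    simpa using hπ φ.toContinuousMap 0
  have h_snd : π.map Prod.snd = ν := by
    refine ext_of_forall_integral_eq_of_IsFiniteMeasure fun ψ => ?_
    rw [integral_map measurable_snd.aemeasurable ψ.continuous.aestronglyMeasurable]
    simpa using hπ 0 ψ.toContinuousMap
  refine ⟨?_, h_fst, h_snd⟩
  have : IsProbabilityMeasure (π.map Prod.fst) := by rwa [h_fst]
  exact Measure.isProbabilityMeasure_of_map Prod.fst

theorem integral_add_integral_nonneg_of_mem_dominationCone [SecondCountableTopology K]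
    [BorelSpace K] [Nonempty J] {m : J → C(K × K, ℝ)} {hm : Directed (· ≤ ·) m} {s : ℝ}
    (h_dual : ∀ j (φ ψ : C(K, ℝ)), (∀ x y, φ x + ψ y ≤ m j (x, y)) →
      ∫ x, φ x ∂μ + ∫ x, ψ x ∂ν ≤ s)
    {φ ψ : C(K, ℝ)} (h_mem : marginalSum (φ, ψ) ∈ dominationCone m hm s) :
    0 ≤ ∫ x, φ x ∂μ + ∫ x, ψ x ∂ν := by
  obtain ⟨a, ha, j, h_dom⟩ := h_mem
  rcases ha.eq_or_lt with rfl | ha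
  · rw [← integral_prod_marginalSum]
    exact integral_nonneg fun p => by simpa using h_dom p
  have h_pot : ∀ x y, (ContinuousMap.const K s - a⁻¹ • φ) x + (-(a⁻¹ • ψ)) y ≤ m j (x, y) := by
    intro x y
    have h_scaled := mul_le_mul_of_nonneg_left (h_dom (x, y)) (inv_nonneg.2 ha.le)
    rw [inv_mul_cancel_left₀ ha.ne', marginalSum_apply] at h_scaled
    simp only [ContinuousMap.sub_apply, ContinuousMap.const_apply, ContinuousMap.neg_apply,
      ContinuousMap.smul_apply, smul_eq_mul]
    linarith
  have h_int := h_dual j _ _ h_pot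
  simp only [ContinuousMap.sub_apply, ContinuousMap.const_apply, ContinuousMap.neg_apply,
      ContinuousMap.smul_apply, smul_eq_mul] at h_int
  rw [integral_sub (integrable_const _) ((integrable_continuousMap φ μ).const_mul _),
    integral_neg, integral_const_mul, integral_const_mul, integral_const, probReal_univ,
    one_smul] at h_int
  exact nonneg_of_mul_nonneg_right (by linarith) (inv_pos.2 ha)

/-- Kantorovich duality on a compact space. By the Riesz extension theorem the functional
`φ ⊕ ψ ↦ ∫ φ dμ + ∫ ψ dν` extends to a functional that is positive on `dominationCone`, and a
positive functional on `C(K × K, ℝ)` is a measure. -/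
theorem exists_coupling_integral_le [T2Space K] [SecondCountableTopology K] [BorelSpace K]
    [Nonempty J] {m : J → C(K × K, ℝ)} (hm : Directed (· ≤ ·) m) {s : ℝ}
    (h_dual : ∀ j (φ ψ : C(K, ℝ)), (∀ x y, φ x + ψ y ≤ m j (x, y)) →
      ∫ x, φ x ∂μ + ∫ x, ψ x ∂ν ≤ s) :
    ∃ π ∈ couplings μ ν, ∀ j, ∫ p, m j p ∂π ≤ s := by
  obtain ⟨L, hL_ext, hL_pos⟩ := riesz_extension (dominationCone m hm s)
    ⟨LinearMap.range marginalSum, (integralLinearMap (μ.prod ν)).domRestrict _⟩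
    (by
      rintro ⟨_, ⟨φ, ψ⟩, rfl⟩ h_mem
      exact (integral_add_integral_nonneg_of_mem_dominationCone h_dual h_mem).trans_eq
        (integral_prod_marginalSum φ ψ).symm)
    (fun u => by
      refine ⟨⟨marginalSum (ContinuousMap.const K ‖u‖, 0), _, rfl⟩,
        mem_dominationCone_of_nonneg fun p => ?_⟩
      simpa using neg_le_iff_add_nonneg'.1 (abs_le.1 (u.norm_coe_le_norm p)).1)
  have hL (φ ψ : C(K, ℝ)) : L (marginalSum (φ, ψ)) = ∫ x, φ x ∂μ + ∫ x, ψ x ∂ν :=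
    (hL_ext ⟨_, (φ, ψ), rfl⟩).trans (integral_prod_marginalSum φ ψ)
  obtain ⟨π, hπ, hπL⟩ := exists_measure_integral_eq L fun u hu =>
    hL_pos u (mem_dominationCone_of_nonneg hu)
  refine ⟨π, mem_couplings_of_integral_marginalSum fun φ ψ => (hπL _).trans (hL φ ψ), fun j => ?_⟩
  have h_const : ContinuousMap.const (K × K) s = marginalSum (ContinuousMap.const K s, 0) := by
    ext; simp
  have h_pos := hL_pos _ (const_sub_mem_dominationCone (hm := hm) (s := s) j)
  rw [map_sub, ← hπL (m j), h_const, hL] at h_pos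
  simpa using h_pos

end CompactDuality

section Duality

/-- The `c`-transform of Kantorovich duality. -/
theorem exists_lipschitzWith_one_between {X : Type*} [PseudoMetricSpace X] [Nonempty X]
    {φ ψ : X → ℝ} (h : ∀ x y, φ x + ψ y ≤ dist x y) :
    ∃ k : X → ℝ, LipschitzWith 1 k ∧ (∀ x, φ x ≤ k x) ∧ ∀ x, ψ x ≤ -k x := by
  have h_bdd (x : X) : BddBelow (Set.range fun y => dist x y - ψ y) :=
    ⟨φ x, Set.forall_mem_range.2 fun y => by linarith [h x y]⟩
  refine ⟨fun x => ⨅ y, (dist x y - ψ y), .of_le_add fun x z => ?_,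
    fun x => le_ciInf fun y => by linarith [h x y], fun x => ?_⟩
  · rw [← sub_le_iff_le_add]
    exact le_ciInf fun y => by linarith [ciInf_le (h_bdd x) y, dist_triangle x z y]
  · linarith [ciInf_le (h_bdd x) x, dist_self x]

theorem exists_coupling_map_eq {X Y : Type*} [MeasurableSpace X] [MeasurableSpace Y]
    {F : X → Y} (hF : MeasurableEmbedding F) {μ ν : Measure X} {π : Measure (Y × Y)}
    (hπ : π ∈ couplings (μ.map F) (ν.map F)) :
    ∃ γ ∈ couplings μ ν, γ.map (Prod.map F F) = π := by
  obtain ⟨hπ_prob, h_fst, h_snd⟩ := hπ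
  have hFF : MeasurableEmbedding (Prod.map F F) := hF.prodMap hF
  have h_fst_mem : ∀ᵐ p ∂π, p.1 ∈ Set.range F :=
    ae_of_ae_map measurable_fst.aemeasurable <| by
      rw [h_fst]; exact ae_map_mem_range F hF.measurableSet_range μ
  have h_snd_mem : ∀ᵐ p ∂π, p.2 ∈ Set.range F :=
    ae_of_ae_map measurable_snd.aemeasurable <| by
      rw [h_snd]; exact ae_map_mem_range F hF.measurableSet_range ν
  have h_map : (π.comap (Prod.map F F)).map (Prod.map F F) = π := by
    rw [hFF.map_comap, Measure.restrict_eq_self_of_ae_mem]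
    filter_upwards [h_fst_mem, h_snd_mem] with p h₁ h₂
    rw [Set.range_prodMap]
    exact ⟨h₁, h₂⟩
  have map_injective {ρ₁ ρ₂ : Measure X} (h : ρ₁.map F = ρ₂.map F) : ρ₁ = ρ₂ := by
    rw [← hF.comap_map ρ₁, h, hF.comap_map]
  refine ⟨_, ⟨?_, map_injective ?_, map_injective ?_⟩, h_map⟩
  · rw [← h_map] at hπ_prob
    exact Measure.isProbabilityMeasure_of_map (Prod.map F F)
  · rw [Measure.map_map hF.measurable measurable_fst, ← h_fst, ← Prod.map_fst',
      ← Measure.map_map measurable_fst hFF.measurable, h_map]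
  · rw [Measure.map_map hF.measurable measurable_snd, ← h_snd, ← Prod.map_snd',
      ← Measure.map_map measurable_snd hFF.measurable, h_map]

variable {X ι : Type*} [MeasurableSpace X]

theorem integral_mem_Icc {f : X → ℝ} (hf : ∀ x, f x ∈ Set.Icc (0 : ℝ) 1) (ρ : Measure X)
    [IsProbabilityMeasure ρ] : ∫ x, f x ∂ρ ∈ Set.Icc (0 : ℝ) 1 := by
  refine ⟨integral_nonneg fun x => (hf x).1, ?_⟩
  have h_le := integral_mono_of_nonneg (ae_of_all ρ fun x => (hf x).1) (integrable_const 1)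
    (ae_of_all ρ fun x => (hf x).2)
  simpa using h_le

variable {g : ι → X → ℝ} {μ ν : Measure X} [IsProbabilityMeasure μ] [IsProbabilityMeasure ν]

namespace IsApproxLattice

variable [Nonempty ι] (H : IsApproxLattice g) (hg : ∀ i, Measurable (g i))

include H hg

theorem integral_add_integral_le {s : ℝ} (hs : ∀ i, |∫ x, g i x ∂μ - ∫ x, g i x ∂ν| ≤ s)
    {S : Finset ι} {φ ψ : X → ℝ} (hφ : Integrable φ μ) (hψ : Integrable ψ ν)
    (h : ∀ x y, φ x + ψ y ≤ finDist g S x y) :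
    ∫ x, φ x ∂μ + ∫ x, ψ x ∂ν ≤ s := by
  have : Nonempty X := nonempty_of_isProbabilityMeasure μ
  let : PseudoMetricSpace X := .induced (fun x (i : S) => g i x) inferInstance
  obtain ⟨k, hk_lip, hφk, hψk⟩ := exists_lipschitzWith_one_between h
  obtain ⟨b, hb⟩ := H.exists_sub_const_mem (S := S) (h := k) fun x y =>
    (hk_lip.dist_le_mul x y).trans_eq (one_mul _)
  refine le_of_forall_pos_le_add fun ε hε => ?_
  obtain ⟨i, hi⟩ := hb (ε / 2) (half_pos hε)
  have h_int (ρ : Measure X) [IsProbabilityMeasure ρ] : Integrable (g i) ρ :=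
    .of_mem_Icc 0 1 (hg i).aemeasurable (ae_of_all _ (H.mem_Icc i))
  have hφ_le : ∫ x, φ x ∂μ ≤ ∫ x, g i x ∂μ + (b + ε / 2) := calc
    _ ≤ ∫ x, (g i x + (b + ε / 2)) ∂μ :=
      integral_mono hφ ((h_int μ).add (integrable_const _)) fun x => by
        linarith [hφk x, (abs_le.1 (hi x)).1]
    _ = _ := by
      rw [integral_add (h_int μ) (integrable_const _), integral_const, probReal_univ, one_smul]
  have hψ_le : ∫ x, ψ x ∂ν ≤ (ε / 2 - b) - ∫ x, g i x ∂ν := calc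
    _ ≤ ∫ x, ((ε / 2 - b) - g i x) ∂ν :=
      integral_mono hψ ((integrable_const _).sub (h_int ν)) fun x => by
        linarith [hψk x, (abs_le.1 (hi x)).2]
    _ = _ := by
      rw [integral_sub (integrable_const _) (h_int ν), integral_const, probReal_univ, one_smul]
  linarith [(abs_le.1 (hs i)).2]

theorem exists_coupling_of_measurableEmbedding {K : Type*} [TopologicalSpace K] [CompactSpace K]
    [T2Space K] [SecondCountableTopology K] [MeasurableSpace K] [BorelSpace K] {F : X → K}
    (hF : MeasurableEmbedding F) {G : ι → C(K, ℝ)} (hG : ∀ i x, G i (F x) = g i x) {s : ℝ}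
    (hs : ∀ i, |∫ x, g i x ∂μ - ∫ x, g i x ∂ν| ≤ s) :
    ∃ γ ∈ couplings μ ν, ∀ S : Finset ι, ∫ p, finDist g S p.1 p.2 ∂γ ≤ s := by
  classical
  obtain rfl : (fun i x => G i (F x)) = g := funext₂ hG
  let m (S : Finset ι) : C(K × K, ℝ) :=
    ⟨fun p => finDist (fun i => G i) S p.1 p.2, by unfold finDist; fun_prop⟩
  have hm : Monotone m := fun S T hST p => finDist_mono (g := fun i => G i) hST
  have hμF := Measure.isProbabilityMeasure_map (μ := μ) hF.measurable.aemeasurable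
  have hνF := Measure.isProbabilityMeasure_map (μ := ν) hF.measurable.aemeasurable
  have h_dual (S : Finset ι) (φ ψ : C(K, ℝ)) (h : ∀ x y, φ x + ψ y ≤ m S (x, y)) :
      ∫ x, φ x ∂(μ.map F) + ∫ x, ψ x ∂(ν.map F) ≤ s := by
    rw [hF.integral_map, hF.integral_map]
    exact H.integral_add_integral_le hg hs
      ((integrable_continuousMap φ _).comp_measurable hF.measurable)
      ((integrable_continuousMap ψ _).comp_measurable hF.measurable) fun x y => h (F x) (F y)
  obtain ⟨π, hπ, hπm⟩ := exists_coupling_integral_le hm.directed_le h_dual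
  obtain ⟨γ, hγ, rfl⟩ := exists_coupling_map_eq hF hπ
  refine ⟨γ, hγ, fun S => ?_⟩
  have hS := hπm S
  rwa [(hF.prodMap hF).integral_map] at hS

/-- Embedding `X` into a compact space to which every `g i` extends continuously; the Cantor space
factor makes the embedding injective. -/
theorem exists_coupling_integral_finDist_le [StandardBorelSpace X] [Countable ι] {s : ℝ}
    (hs : ∀ i, |∫ x, g i x ∂μ - ∫ x, g i x ∂ν| ≤ s) :
    ∃ γ ∈ couplings μ ν, ∀ S : Finset ι, ∫ p, finDist g S p.1 p.2 ∂γ ≤ s := by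
  obtain ⟨e, he, he_inj⟩ :=
    MeasurableSpace.measurable_injection_nat_bool_of_countablySeparated X
  let F (x : X) : (ι → unitInterval) × (ℕ → Bool) := (fun i => ⟨g i x, H.mem_Icc i x⟩, e x)
  have hF : Measurable F := (measurable_pi_lambda _ fun i => (hg i).subtype_mk).prodMk he
  have hF_inj : Function.Injective F := fun x y hxy => he_inj (congrArg Prod.snd hxy)
  exact H.exists_coupling_of_measurableEmbedding hg (hF.measurableEmbedding hF_inj)
    (G := fun i => ⟨fun k => k.1 i, by fun_prop⟩) (fun _ _ => rfl) hs

end IsApproxLattice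

theorem measurable_finDist (hg : ∀ i, Measurable (g i)) (S : Finset ι) :
    Measurable fun p : X × X => finDist g S p.1 p.2 := by
  unfold finDist
  fun_prop

theorem lintegral_iSup_abs_sub_le [Countable ι] (hg : ∀ i, Measurable (g i)) {γ : Measure (X × X)}
    {s : ℝ} (h_int : ∀ S, Integrable (fun p => finDist g S p.1 p.2) γ)
    (hs : ∀ S : Finset ι, ∫ p, finDist g S p.1 p.2 ∂γ ≤ s) :
    ∫⁻ p, ⨆ i, ENNReal.ofReal |g i p.1 - g i p.2| ∂γ ≤ ENNReal.ofReal s := by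
  classical
  calc ∫⁻ p, ⨆ i, ENNReal.ofReal |g i p.1 - g i p.2| ∂γ
      ≤ ∫⁻ p, ⨆ S : Finset ι, ENNReal.ofReal (finDist g S p.1 p.2) ∂γ :=
        lintegral_mono fun p => iSup_le fun i => le_iSup_of_le {i} <|
          ENNReal.ofReal_le_ofReal (abs_sub_le_finDist (Finset.mem_singleton_self i))
    _ = ⨆ S : Finset ι, ∫⁻ p, ENNReal.ofReal (finDist g S p.1 p.2) ∂γ :=
        lintegral_iSup_directed
          (fun S => (measurable_finDist hg S).ennreal_ofReal.aemeasurable)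
          (Monotone.directed_le fun _ _ hST _ => ENNReal.ofReal_le_ofReal (finDist_mono hST))
    _ ≤ ENNReal.ofReal s := iSup_le fun S => by
        rw [← ofReal_integral_eq_lintegral_ofReal (h_int S)
          (ae_of_all _ fun _ => finDist_nonneg)]
        exact ENNReal.ofReal_le_ofReal (hs S)

theorem IsApproxLattice.transport_iSup_le [StandardBorelSpace X] [Countable ι] [Nonempty ι]
    (H : IsApproxLattice g) (hg : ∀ i, Measurable (g i)) :
    transport (fun x y => ⨆ i, ENNReal.ofReal |g i x - g i y|) μ ν ≤
      ⨆ i, ENNReal.ofReal |∫ x, g i x ∂μ - ∫ x, g i x ∂ν| := by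
  set D := ⨆ i, ENNReal.ofReal |∫ x, g i x ∂μ - ∫ x, g i x ∂ν|
  have hD_top : D ≠ ∞ := by
    refine ne_top_of_le_ne_top ENNReal.one_ne_top (iSup_le fun i => ENNReal.ofReal_le_one.2 ?_)
    exact Real.dist_le_of_mem_Icc_01 (integral_mem_Icc (H.mem_Icc i) μ)
      (integral_mem_Icc (H.mem_Icc i) ν)
  have hs (i : ι) : |∫ x, g i x ∂μ - ∫ x, g i x ∂ν| ≤ D.toReal :=
    (ENNReal.ofReal_le_iff_le_toReal hD_top).1
      (le_iSup (fun i => ENNReal.ofReal |∫ x, g i x ∂μ - ∫ x, g i x ∂ν|) i)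
  obtain ⟨γ, hγ, hγ_le⟩ := H.exists_coupling_integral_finDist_le hg hs
  have : IsProbabilityMeasure γ := hγ.1
  have h_int (S : Finset ι) : Integrable (fun p => finDist g S p.1 p.2) γ :=
    .of_mem_Icc 0 1 (measurable_finDist hg S).aemeasurable
      (ae_of_all _ fun _ => ⟨finDist_nonneg, H.finDist_le_one⟩)
  calc transport (fun x y => ⨆ i, ENNReal.ofReal |g i x - g i y|) μ ν
      ≤ ∫⁻ p, ⨆ i, ENNReal.ofReal |g i p.1 - g i p.2| ∂γ := iInf₂_le γ hγ
    _ ≤ ENNReal.ofReal D.toReal := lintegral_iSup_abs_sub_le hg h_int hγ_le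
    _ = D := ENNReal.ofReal_toReal hD_top

end Duality

section StandardBorel

theorem denseRange_nnratCast_nnreal : DenseRange ((↑) : ℚ≥0 → ℝ≥0) := by
  refine dense_of_exists_between fun a b hab => ?_
  obtain ⟨q, hq, haq, hqb⟩ := (NNReal.lt_iff_exists_rat_btwn a b).1 hab
  lift q to ℚ≥0 using hq
  have h_cast : Real.toNNReal ((q : ℚ) : ℝ) = (q : ℝ≥0) := by
    ext
    rw [Real.coe_toNNReal _ (by positivity)]
    norm_cast
  exact ⟨q, ⟨q, rfl⟩, h_cast ▸ haq, h_cast ▸ hqb⟩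

/-- By the Lusin-Souslin theorem, countably many functions that separate the points of a Polish
space generate its Borel `σ`-algebra. -/
theorem standardBorelSpace_of_le_borel {Y Z : Type*} [TopologicalSpace Y] [PolishSpace Y]
    {m : MeasurableSpace Y} [MeasurableSpace Z] [MeasurableSpace.CountablySeparated Z]
    (hm : m ≤ borel Y) {r : Y → Z} (hr : Measurable[m] r) (hr_inj : Function.Injective r) :
    @StandardBorelSpace Y m := by
  have hm_eq : m = borel Y := by
    refine le_antisymm hm ?_
    have hr_borel : Measurable[borel Y] r := hr.mono hm le_rfl
    let _ : MeasurableSpace Y := borel Y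
    have : BorelSpace Y := ⟨rfl⟩
    rw [← (hr_borel.measurableEmbedding hr_inj).comap_eq]
    exact hr.comap_le
  exact @StandardBorelSpace.mk Y m ⟨inferInstance, @BorelSpace.mk Y _ m hm_eq, inferInstance⟩

variable (E : Type*) [TopologicalSpace E]

/-- A locally compact space is open in its completion. -/
theorem polishSpace_of_locallyCompactSpace [LocallyCompactSpace E] [T2Space E]
    [SecondCountableTopology E] : PolishSpace E := by
  let := TopologicalSpace.metrizableSpaceMetric E
  have h_dense : IsDenseInducing ((↑) : E → UniformSpace.Completion E) :=
    UniformSpace.Completion.isDenseInducing_coe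
  have h_emb : IsEmbedding ((↑) : E → UniformSpace.Completion E) :=
    UniformSpace.Completion.coe_isometry.isEmbedding
  have h_open : IsOpen (Set.range ((↑) : E → UniformSpace.Completion E)) := by
    rw [isOpen_iff_mem_nhds]
    rintro _ ⟨x, rfl⟩
    obtain ⟨K, hK, hKx⟩ := exists_compact_mem_nhds x
    have h_nhds := h_dense.closure_image_mem_nhds hKx
    rw [(hK.image h_dense.continuous).isClosed.closure_eq] at h_nhds
    exact Filter.mem_of_superset h_nhds (Set.image_subset_range _ K)
  have := h_open.polishSpace
  exact h_emb.toHomeomorph.isClosedEmbedding.polishSpace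

theorem polishSpace_trajectory [PolishSpace E] : PolishSpace (Trajectory E) := by
  let := TopologicalSpace.upgradeIsCompletelyMetrizable E
  infer_instance

variable [MeasurableSpace E]

theorem measurable_trajectory_apply (t : ℝ≥0) : Measurable fun ω : Trajectory E => ω t :=
  measurable_iff_comap_le.2 <|
    le_iSup (fun t => MeasurableSpace.comap (fun ω : Trajectory E => ω t) inferInstance) t

theorem standardBorelSpace_trajectory [BorelSpace E] [PolishSpace E] :
    StandardBorelSpace (Trajectory E) := by
  have := polishSpace_trajectory E
  let r (ω : Trajectory E) (q : ℚ≥0) : E := ω (q : ℝ≥0)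
  have hr : Measurable r := measurable_pi_lambda _ fun q => measurable_trajectory_apply E q
  have hr_inj : Function.Injective r := fun ω ω' h => DFunLike.coe_injective <|
    denseRange_nnratCast_nnreal.equalizer ω.continuous ω'.continuous h
  refine standardBorelSpace_of_le_borel (iSup_le fun t => ?_) hr hr_inj
  rw [BorelSpace.measurable_eq (α := E)]
  exact (borel_comap (f := fun ω : Trajectory E => ω t)).symm.le.trans
    (borel_anti (continuous_eval_const t).le_induced)

end StandardBorel

section Transport

variable {X : Type*} [MeasurableSpace X] {k : X → X → ℝ≥0∞} {μ ν : Measure X}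

theorem transport_mono : Monotone (transport (X := X)) :=
  fun _ _ hkl _ _ => iInf₂_mono fun _ _ => lintegral_mono fun p => hkl p.1 p.2

theorem le_transport_of_ae {a : ℝ≥0∞} {p q : X → Prop} (hp : ∀ᵐ x ∂μ, p x) (hq : ∀ᵐ y ∂ν, q y)
    (h : ∀ x y, p x → q y → a ≤ k x y) : a ≤ transport k μ ν := by
  refine le_iInf₂ fun γ ⟨hγ, h_fst, h_snd⟩ => ?_
  rw [← h_fst] at hp
  rw [← h_snd] at hq
  calc a = ∫⁻ _, a ∂γ := by simp
    _ ≤ ∫⁻ p, k p.1 p.2 ∂γ := lintegral_mono_ae <| by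
      filter_upwards [ae_of_ae_map measurable_fst.aemeasurable hp,
        ae_of_ae_map measurable_snd.aemeasurable hq] with z hz₁ hz₂
      exact h _ _ hz₁ hz₂

theorem ofReal_abs_integral_sub_le_transport {f : X → ℝ} (hf : Measurable f)
    (hfμ : Integrable f μ) (hfν : Integrable f ν)
    (h : ∀ x y, ENNReal.ofReal |f x - f y| ≤ k x y) :
    ENNReal.ofReal |∫ x, f x ∂μ - ∫ x, f x ∂ν| ≤ transport k μ ν := by
  refine le_iInf₂ fun γ ⟨_, h_fst, h_snd⟩ => ?_
  have h_int_fst : Integrable (fun p : X × X => f p.1) γ :=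
    Integrable.comp_measurable (by rwa [h_fst]) measurable_fst
  have h_int_snd : Integrable (fun p : X × X => f p.2) γ :=
    Integrable.comp_measurable (by rwa [h_snd]) measurable_snd
  rw [← h_fst, ← h_snd, integral_map measurable_fst.aemeasurable hf.aestronglyMeasurable,
    integral_map measurable_snd.aemeasurable hf.aestronglyMeasurable,
    ← integral_sub h_int_fst h_int_snd, ← Real.norm_eq_abs, ofReal_norm]
  refine (enorm_integral_le_lintegral_enorm _).trans (lintegral_mono fun p => ?_)
  rw [← ofReal_norm, Real.norm_eq_abs]
  exact h _ _

end Transport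

namespace Diffusion

variable {E : Type*} [TopologicalSpace E] [MeasurableSpace E] (D : Diffusion E)

instance (t : ℝ≥0) : IsMarkovKernel (D.kernel t) := D.honest t

instance (x : E) : IsProbabilityMeasure (D.law x) := D.law_prob x

theorem map_apply_zero_law (x : E) : (D.law x).map (fun ω => ω 0) = Measure.dirac x := by
  ext C hC
  rw [Measure.map_apply (measurable_trajectory_apply E 0) hC]
  simpa [cylinderProb, Set.preimage] using D.law_cylinder x C [] hC (by simp) (by simp)

theorem ae_law_apply_zero_eq [MeasurableSingletonClass E] (x : E) :
    ∀ᵐ ω ∂(D.law x), ω 0 = x := by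
  refine ae_of_ae_map (measurable_trajectory_apply E 0).aemeasurable (p := fun y => y = x) ?_
  rw [D.map_apply_zero_law]
  exact (ae_dirac_iff (measurableSet_singleton x)).2 rfl

theorem continuous_integral_law [SequentialSpace E] {g : Trajectory E → ℝ}
    (hg : Continuous g) (hg_mem : ∀ ω, g ω ∈ Set.Icc (0 : ℝ) 1) :
    Continuous fun x => ∫ ω, g ω ∂(D.law x) :=
  continuous_iff_seqContinuous.2 fun u x hu => D.law_continuous u x hu <|
    .ofNormedAddCommGroup g hg 1 fun ω => by
      rw [Real.norm_of_nonneg (hg_mem ω).1]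
      exact (hg_mem ω).2

variable [BorelSpace E] [LocallyCompactSpace E] [T2Space E] [SecondCountableTopology E]

theorem kernel_zero (x : E) : D.kernel 0 x = Measure.dirac x := by
  have := polishSpace_of_locallyCompactSpace E
  refine Measure.ext_of_integral_eq_on_compactlySupported fun f => ?_
  rw [integral_dirac]
  calc ∫ y, f y ∂(D.kernel 0 x) = D.op 0 (f : C₀(E, ℝ)) x := (D.op_eq_integral 0 f x).symm
    _ = f x := by rw [D.op_zero]; rfl

theorem map_apply_law (t : ℝ≥0) (x : E) : (D.law x).map (fun ω => ω t) = D.kernel t x := by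
  rcases eq_or_ne t 0 with rfl | ht
  · rw [D.map_apply_zero_law, D.kernel_zero]
  ext C hC
  rw [Measure.map_apply (measurable_trajectory_apply E t) hC]
  have h_cyl := D.law_cylinder x Set.univ [(t, C)] MeasurableSet.univ (by simpa using hC)
    (by simpa using pos_iff_ne_zero.2 ht)
  simpa [cylinderProb, Set.preimage] using h_cyl

theorem integral_kernel {f : E → ℝ} (hf : Measurable f) (t : ℝ≥0) (x : E) :
    ∫ y, f y ∂(D.kernel t x) = ∫ ω, f (ω t) ∂(D.law x) := by
  rw [← D.map_apply_law,
    integral_map (measurable_trajectory_apply E t).aemeasurable hf.aestronglyMeasurable]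

variable {f : E → ℝ} (hf : Continuous f) (hf_mem : ∀ x, f x ∈ Set.Icc (0 : ℝ) 1)

include hf hf_mem

theorem continuous_integral_kernel (t : ℝ≥0) :
    Continuous fun x => ∫ y, f y ∂(D.kernel t x) := by
  simp only [D.integral_kernel hf.measurable]
  exact D.continuous_integral_law (hf.comp (continuous_eval_const t)) fun ω => hf_mem _

theorem continuous_integral_kernel_time (x : E) :
    Continuous fun t : ℝ≥0 => ∫ y, f y ∂(D.kernel t x) := by
  simp only [D.integral_kernel hf.measurable]
  refine continuous_of_dominated (bound := fun _ => 1)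
    (fun t => (hf.measurable.comp (measurable_trajectory_apply E t)).aestronglyMeasurable)
    (fun t => ae_of_all _ fun ω => ?_) (integrable_const _) (ae_of_all _ fun ω => by fun_prop)
  rw [Real.norm_of_nonneg (hf_mem _).1]
  exact (hf_mem _).2

end Diffusion

section Discount

variable {c : ℝ}

theorem rpow_nnratCast_mem_Icc (hc0 : 0 ≤ c) (hc1 : c ≤ 1) (t : ℚ≥0) :
    c ^ (t : ℝ) ∈ Set.Icc (0 : ℝ) 1 :=
  ⟨Real.rpow_nonneg hc0 _, Real.rpow_le_one hc0 hc1 t.cast_nonneg⟩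

theorem ofReal_rpow_mul (hc0 : 0 ≤ c) (t a b : ℝ) :
    ENNReal.ofReal (c ^ t) * ENNReal.ofReal |a - b| =
      ENNReal.ofReal |c ^ t * a - c ^ t * b| := by
  have hct := Real.rpow_nonneg hc0 t
  rw [← ENNReal.ofReal_mul hct, ← mul_sub, abs_mul, abs_of_nonneg hct]

theorem coe_nnratCast_nnreal (q : ℚ≥0) : ((q : ℝ≥0) : ℝ) = q := by
  norm_cast

theorem ofReal_rpow_mul_le_of_rat (hc0 : 0 < c) {u v : ℝ≥0 → ℝ} (hu : Continuous u)
    (hv : Continuous v) {a : ℝ≥0∞}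
    (h : ∀ q : ℚ≥0, ENNReal.ofReal |c ^ (q : ℝ) * u q - c ^ (q : ℝ) * v q| ≤ a) (t : ℝ≥0) :
    ENNReal.ofReal (c ^ (t : ℝ)) * ENNReal.ofReal |u t - v t| ≤ a := by
  rw [ofReal_rpow_mul hc0.le]
  have hc : Continuous fun t : ℝ≥0 => c ^ (t : ℝ) :=
    (Real.continuous_const_rpow hc0.ne').comp NNReal.continuous_coe
  induction t using denseRange_nnratCast_nnreal.induction_on with
  | hp => exact isClosed_le (ENNReal.continuous_ofReal.comp (by fun_prop)) continuous_const
  | ih q => simpa only [coe_nnratCast_nnreal] using h q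

end Discount

section Truncation

theorem ratCast_mem_Icc (q : Set.Icc (0 : ℚ) 1) : ((q : ℚ) : ℝ) ∈ Set.Icc (0 : ℝ) 1 :=
  ⟨by exact_mod_cast q.2.1, by exact_mod_cast q.2.2⟩

theorem min_mem_Icc {a b : ℝ} (ha : a ∈ Set.Icc (0 : ℝ) 1) (hb : b ∈ Set.Icc (0 : ℝ) 1) :
    min a b ∈ Set.Icc (0 : ℝ) 1 :=
  ⟨le_min ha.1 hb.1, min_le_of_left_le ha.2⟩

theorem max_mem_Icc {a b : ℝ} (ha : a ∈ Set.Icc (0 : ℝ) 1) (hb : b ∈ Set.Icc (0 : ℝ) 1) :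
    max a b ∈ Set.Icc (0 : ℝ) 1 :=
  ⟨le_max_of_le_left ha.1, max_le ha.2 hb.2⟩

theorem max_zero_sub_mem_Icc {a q : ℝ} (ha : a ≤ 1) (hq : 0 ≤ q) :
    max 0 (a - q) ∈ Set.Icc (0 : ℝ) 1 :=
  ⟨le_max_left _ _, max_le zero_le_one (by linarith)⟩

theorem min_one_add_mem_Icc {a q : ℝ} (ha : 0 ≤ a) (hq : 0 ≤ q) :
    min 1 (a + q) ∈ Set.Icc (0 : ℝ) 1 :=
  ⟨le_min zero_le_one (add_nonneg ha hq), min_le_left _ _⟩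

theorem abs_max_zero_sub_sub_le (a b q : ℝ) : |max 0 (a - q) - max 0 (b - q)| ≤ |a - b| := by
  simpa using abs_max_sub_max_le_max 0 (a - q) 0 (b - q)

theorem abs_min_one_add_sub_le (a b q : ℝ) : |min 1 (a + q) - min 1 (b + q)| ≤ |a - b| := by
  simpa using abs_min_sub_min_le_max 1 (a + q) 1 (b + q)

end Truncation

section NonexpansiveForSome

variable {X : Type*}

/-- The function `h` is non-expansive for one of the pseudometrics `a n`. The formulas of both
logics have this property with respect to the iterates of the corresponding functional. -/
def NonexpansiveForSome (a : ℕ → X → X → ℝ≥0∞) (h : X → ℝ) : Prop :=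
  ∃ n, ∀ x y, ENNReal.ofReal |h x - h y| ≤ a n x y

namespace NonexpansiveForSome

variable {a : ℕ → X → X → ℝ≥0∞} {f g h : X → ℝ}

theorem const (r : ℝ) : NonexpansiveForSome a fun _ => r :=
  ⟨0, by simp⟩

theorem of_abs_le (hf : NonexpansiveForSome a f) (h_le : ∀ x y, |h x - h y| ≤ |f x - f y|) :
    NonexpansiveForSome a h :=
  hf.imp fun _ hn x y => (ENNReal.ofReal_le_ofReal (h_le x y)).trans (hn x y)

theorem of_abs_le_max (ha : Monotone a) (hf : NonexpansiveForSome a f)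
    (hg : NonexpansiveForSome a g) (h_le : ∀ x y, |h x - h y| ≤ max |f x - f y| |g x - g y|) :
    NonexpansiveForSome a h := by
  obtain ⟨n, hn⟩ := hf
  obtain ⟨k, hk⟩ := hg
  refine ⟨n ⊔ k, fun x y => (ENNReal.ofReal_le_ofReal (h_le x y)).trans ?_⟩
  rw [ENNReal.ofReal_max]
  exact max_le ((hn x y).trans (ha le_sup_left x y)) ((hk x y).trans (ha le_sup_right x y))

theorem min (ha : Monotone a) (hf : NonexpansiveForSome a f) (hg : NonexpansiveForSome a g) :
    NonexpansiveForSome a fun x => Min.min (f x) (g x) :=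
  of_abs_le_max ha hf hg fun _ _ => abs_min_sub_min_le_max _ _ _ _

theorem max (ha : Monotone a) (hf : NonexpansiveForSome a f) (hg : NonexpansiveForSome a g) :
    NonexpansiveForSome a fun x => Max.max (f x) (g x) :=
  of_abs_le_max ha hf hg fun _ _ => abs_max_sub_max_le_max _ _ _ _

theorem one_sub (hf : NonexpansiveForSome a f) : NonexpansiveForSome a fun x => 1 - f x :=
  hf.of_abs_le fun x y => by rw [sub_sub_sub_cancel_left, abs_sub_comm]

theorem tsub (hf : NonexpansiveForSome a f) (q : ℝ) :
    NonexpansiveForSome a fun x => Max.max 0 (f x - q) :=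
  hf.of_abs_le fun _ _ => abs_max_zero_sub_sub_le _ _ _

theorem tadd (hf : NonexpansiveForSome a f) (q : ℝ) :
    NonexpansiveForSome a fun x => Min.min 1 (f x + q) :=
  hf.of_abs_le fun _ _ => abs_min_one_add_sub_le _ _ _

end NonexpansiveForSome

end NonexpansiveForSome

section Functionals

variable {E : Type*} [TopologicalSpace E] {c : ℝ}

theorem discountedUniform_mono : Monotone (discountedUniform (E := E) c) :=
  fun _ _ hm _ _ => iSup_mono fun _ => mul_le_mul_right (hm _ _) _

theorem le_discountedUniform (m : E → E → ℝ≥0∞) (ω ω' : Trajectory E) (t : ℝ≥0) :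
    ENNReal.ofReal (c ^ (t : ℝ)) * m (ω t) (ω' t) ≤ discountedUniform c m ω ω' :=
  le_iSup (fun t : ℝ≥0 => ENNReal.ofReal (c ^ (t : ℝ)) * m (ω t) (ω' t)) t

variable [MeasurableSpace E] (D : Diffusion E) (obs : C(E, unitInterval))

theorem kernelFunctional_mono : Monotone (kernelFunctional D c) :=
  fun _ _ hm _ _ => iSup_mono fun _ => mul_le_mul_right (transport_mono hm _ _) _

theorem trajFunctional_mono : Monotone (trajFunctional D c) :=
  fun _ _ hm _ _ => transport_mono (discountedUniform_mono hm) _ _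

theorem le_trajFunctional [MeasurableSingletonClass E] (m : E → E → ℝ≥0∞) :
    m ≤ trajFunctional D c m :=
  fun x y => le_transport_of_ae (D.ae_law_apply_zero_eq x) (D.ae_law_apply_zero_eq y) <| by
    rintro ω ω' rfl rfl
    simpa using le_discountedUniform (c := c) m ω ω' 0

theorem dSeq_monotone [MeasurableSingletonClass E] : Monotone (dSeq D obs c) :=
  monotone_nat_of_le_succ fun n => le_trajFunctional D (dSeq D obs c n)

variable [BorelSpace E] [LocallyCompactSpace E] [T2Space E] [SecondCountableTopology E]

theorem le_kernelFunctional (m : E → E → ℝ≥0∞) : m ≤ kernelFunctional D c m := by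
  intro x y
  have ae_dirac_eq (z : E) : ∀ᵐ w ∂(Measure.dirac z), w = z :=
    (ae_dirac_iff (measurableSet_singleton z)).2 rfl
  have h_zero : m x y ≤ transport m (D.kernel 0 x) (D.kernel 0 y) := by
    rw [D.kernel_zero, D.kernel_zero]
    exact le_transport_of_ae (ae_dirac_eq x) (ae_dirac_eq y) (by rintro _ _ rfl rfl; rfl)
  exact le_iSup_of_le 0 (by simpa using h_zero)

theorem deltaSeq_monotone : Monotone (deltaSeq D obs c) :=
  monotone_nat_of_le_succ fun n => le_kernelFunctional D (deltaSeq D obs c n)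

theorem map_apply_mem_couplings {x y : E} {γ : Measure (Trajectory E × Trajectory E)}
    (hγ : γ ∈ couplings (D.law x) (D.law y)) (t : ℝ≥0) :
    γ.map (fun p => (p.1 t, p.2 t)) ∈ couplings (D.kernel t x) (D.kernel t y) := by
  obtain ⟨hγ_prob, h_fst, h_snd⟩ := hγ
  have h_eval := measurable_trajectory_apply E t
  have h_pair : Measurable fun p : Trajectory E × Trajectory E => (p.1 t, p.2 t) :=
    (h_eval.comp measurable_fst).prodMk (h_eval.comp measurable_snd)
  refine ⟨Measure.isProbabilityMeasure_map h_pair.aemeasurable, ?_, ?_⟩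
  · rw [← D.map_apply_law, ← h_fst, Measure.map_map measurable_fst h_pair,
      Measure.map_map h_eval measurable_fst]
    rfl
  · rw [← D.map_apply_law, ← h_snd, Measure.map_map measurable_snd h_pair,
      Measure.map_map h_eval measurable_snd]
    rfl

theorem kernelFunctional_le_trajFunctional (m : E → E → ℝ≥0∞) :
    kernelFunctional D c m ≤ trajFunctional D c m := by
  refine fun x y => iSup_le fun t => le_iInf₂ fun γ hγ => ?_
  calc ENNReal.ofReal (c ^ (t : ℝ)) * transport m (D.kernel t x) (D.kernel t y)
      ≤ ENNReal.ofReal (c ^ (t : ℝ)) * ∫⁻ p, m (p.1 t) (p.2 t) ∂γ :=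
        mul_le_mul_right ((iInf₂_le _ (map_apply_mem_couplings D hγ t)).trans
          (lintegral_map_le _ _)) _
    _ ≤ ∫⁻ p, ENNReal.ofReal (c ^ (t : ℝ)) * m (p.1 t) (p.2 t) ∂γ := lintegral_const_mul_le _ _
    _ ≤ ∫⁻ p, discountedUniform c m p.1 p.2 ∂γ :=
        lintegral_mono fun p => le_discountedUniform m p.1 p.2 t

theorem deltaSeq_le_dSeq (n : ℕ) : deltaSeq D obs c n ≤ dSeq D obs c n := by
  induction n with
  | zero => exact le_rfl
  | succ n ih => exact (kernelFunctional_mono D ih).trans (kernelFunctional_le_trajFunctional D _)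

theorem deltaBar_le_dBar : deltaBar D obs c ≤ dBar D obs c :=
  fun x y => iSup_mono fun n => deltaSeq_le_dSeq D obs n x y

end Functionals

section KernelLogic

deriving instance Countable for KernelFormula

instance : Nonempty KernelFormula := ⟨.obs⟩

variable {E : Type*} [TopologicalSpace E] [MeasurableSpace E] (D : Diffusion E)
  (obs : C(E, unitInterval)) {c : ℝ}

namespace KernelFormula

theorem eval_mem_Icc (hc0 : 0 ≤ c) (hc1 : c ≤ 1) (f : KernelFormula) (x : E) :
    f.eval D obs c x ∈ Set.Icc (0 : ℝ) 1 := by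
  induction f generalizing x with
  | const q => exact ratCast_mem_Icc q
  | obs => exact (obs x).2
  | min f₁ f₂ ih₁ ih₂ => exact min_mem_Icc (ih₁ x) (ih₂ x)
  | compl f ih => exact Set.Icc.one_sub_mem (ih x)
  | tsub f q ih => exact max_zero_sub_mem_Icc (ih x).2 (ratCast_mem_Icc q).1
  | diamond t f ih =>
    exact unitInterval.mul_mem (rpow_nnratCast_mem_Icc hc0 hc1 t) (integral_mem_Icc ih _)

theorem le_lambdaDist (f : KernelFormula) (x y : E) :
    ENNReal.ofReal |f.eval D obs c x - f.eval D obs c y| ≤ lambdaDist D obs c x y :=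
  le_iSup (fun f : KernelFormula => ENNReal.ofReal |f.eval D obs c x - f.eval D obs c y|) f

theorem isApproxLattice_eval (hc0 : 0 ≤ c) (hc1 : c ≤ 1) :
    IsApproxLattice fun f : KernelFormula => f.eval D obs c where
  mem_Icc := eval_mem_Icc D obs hc0 hc1
  inf_mem f₁ f₂ := self_mem_uniformClosure _ (KernelFormula.min f₁ f₂)
  compl_mem f := self_mem_uniformClosure _ (KernelFormula.compl f)
  tsub_mem f q := self_mem_uniformClosure _ (KernelFormula.tsub f q)

variable [BorelSpace E] [LocallyCompactSpace E] [T2Space E] [SecondCountableTopology E]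

theorem continuous_eval (hc0 : 0 ≤ c) (hc1 : c ≤ 1) (f : KernelFormula) :
    Continuous (f.eval D obs c) := by
  induction f with
  | const q => exact continuous_const
  | obs => exact continuous_subtype_val.comp obs.continuous
  | min f₁ f₂ ih₁ ih₂ => exact ih₁.min ih₂
  | compl f ih => exact continuous_const.sub ih
  | tsub f q ih => exact continuous_const.max (ih.sub continuous_const)
  | diamond t f ih =>
    exact continuous_const.mul
      (D.continuous_integral_kernel ih (f.eval_mem_Icc D obs hc0 hc1) _)

theorem nonexpansiveForSome_deltaSeq (hc0 : 0 ≤ c) (hc1 : c ≤ 1) (f : KernelFormula) :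
    NonexpansiveForSome (deltaSeq D obs c) (f.eval D obs c) := by
  have h_mono := deltaSeq_monotone D obs (c := c)
  induction f with
  | const q => exact .const _
  | obs => exact ⟨0, fun x y => le_rfl⟩
  | min f₁ f₂ ih₁ ih₂ => exact .min h_mono ih₁ ih₂
  | compl f ih => exact ih.one_sub
  | tsub f q ih => exact ih.tsub q
  | diamond t f ih =>
    obtain ⟨n, hn⟩ := ih
    have hf := (f.continuous_eval D obs hc0 hc1).measurable
    have hf_int (ρ : Measure E) [IsProbabilityMeasure ρ] : Integrable (f.eval D obs c) ρ :=
      .of_mem_Icc 0 1 hf.aemeasurable (ae_of_all _ (f.eval_mem_Icc D obs hc0 hc1))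
    refine ⟨n + 1, fun x y => ?_⟩
    calc ENNReal.ofReal |(diamond t f).eval D obs c x - (diamond t f).eval D obs c y|
        = ENNReal.ofReal (c ^ (t : ℝ)) * ENNReal.ofReal |∫ z, f.eval D obs c z ∂(D.kernel t x) -
            ∫ z, f.eval D obs c z ∂(D.kernel t y)| := (ofReal_rpow_mul hc0 _ _ _).symm
      _ ≤ ENNReal.ofReal (c ^ ((t : ℝ≥0) : ℝ)) *
            transport (deltaSeq D obs c n) (D.kernel t x) (D.kernel t y) := by
          rw [coe_nnratCast_nnreal]
          exact mul_le_mul_right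
            (ofReal_abs_integral_sub_le_transport hf (hf_int _) (hf_int _) hn) _
      _ ≤ deltaSeq D obs c (n + 1) x y :=
          le_iSup (fun s : ℝ≥0 => ENNReal.ofReal (c ^ (s : ℝ)) *
            transport (deltaSeq D obs c n) (D.kernel s x) (D.kernel s y)) t

end KernelFormula

variable [BorelSpace E] [LocallyCompactSpace E] [T2Space E] [SecondCountableTopology E]

theorem kernelFunctional_lambdaDist_le (hc0 : 0 < c) (hc1 : c ≤ 1) :
    kernelFunctional D c (lambdaDist D obs c) ≤ lambdaDist D obs c := by
  have := polishSpace_of_locallyCompactSpace E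
  have h_cont := KernelFormula.continuous_eval D obs hc0.le hc1
  have h_mem := KernelFormula.eval_mem_Icc D obs hc0.le hc1
  refine fun x y => iSup_le fun t => ?_
  calc ENNReal.ofReal (c ^ (t : ℝ)) *
        transport (lambdaDist D obs c) (D.kernel t x) (D.kernel t y)
      ≤ ENNReal.ofReal (c ^ (t : ℝ)) * ⨆ f : KernelFormula, ENNReal.ofReal
          |∫ z, f.eval D obs c z ∂(D.kernel t x) - ∫ z, f.eval D obs c z ∂(D.kernel t y)| :=
        mul_le_mul_right ((KernelFormula.isApproxLattice_eval D obs hc0.le hc1).transport_iSup_le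
          fun f => (h_cont f).measurable) _
    _ ≤ lambdaDist D obs c x y := by
        rw [ENNReal.mul_iSup]
        exact iSup_le fun f => ofReal_rpow_mul_le_of_rat hc0
          (D.continuous_integral_kernel_time (h_cont f) (h_mem f) x)
          (D.continuous_integral_kernel_time (h_cont f) (h_mem f) y)
          (fun q => (KernelFormula.diamond q f).le_lambdaDist D obs x y) t

theorem deltaSeq_le_lambdaDist (hc0 : 0 < c) (hc1 : c ≤ 1) (n : ℕ) :
    deltaSeq D obs c n ≤ lambdaDist D obs c := by
  induction n with
  | zero => exact KernelFormula.obs.le_lambdaDist D obs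
  | succ n ih =>
    exact (kernelFunctional_mono D ih).trans (kernelFunctional_lambdaDist_le D obs hc0 hc1)

theorem lambdaDist_eq_deltaBar (hc0 : 0 < c) (hc1 : c ≤ 1) :
    lambdaDist D obs c = deltaBar D obs c := by
  refine le_antisymm (fun x y => iSup_le fun f => ?_)
    fun x y => iSup_le fun n => deltaSeq_le_lambdaDist D obs hc0 hc1 n x y
  obtain ⟨n, hn⟩ := f.nonexpansiveForSome_deltaSeq D obs hc0.le hc1
  exact le_iSup_of_le n (hn x y)

end KernelLogic

section TrajectoryLogic

deriving instance Countable for StateFormula, TrajFormula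

instance : Nonempty TrajFormula := ⟨.ev .obs 0⟩

variable {E : Type*} [TopologicalSpace E] [MeasurableSpace E] (D : Diffusion E)
  (obs : C(E, unitInterval)) {c : ℝ}

mutual

theorem StateFormula.eval_mem_Icc (hc0 : 0 ≤ c) (hc1 : c ≤ 1) (f : StateFormula) (x : E) :
    f.eval D obs c x ∈ Set.Icc (0 : ℝ) 1 := by
  cases f with simp only [StateFormula.eval]
  | const q => exact ratCast_mem_Icc q
  | obs => exact (obs x).2
  | compl f => exact Set.Icc.one_sub_mem (f.eval_mem_Icc hc0 hc1 x)
  | integral g => exact integral_mem_Icc (g.eval_mem_Icc hc0 hc1) _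

theorem TrajFormula.eval_mem_Icc (hc0 : 0 ≤ c) (hc1 : c ≤ 1) (g : TrajFormula)
    (ω : Trajectory E) : g.eval D obs c ω ∈ Set.Icc (0 : ℝ) 1 := by
  cases g with simp only [TrajFormula.eval]
  | ev f t =>
    exact unitInterval.mul_mem (rpow_nnratCast_mem_Icc hc0 hc1 t) (f.eval_mem_Icc hc0 hc1 _)
  | min g₁ g₂ => exact min_mem_Icc (g₁.eval_mem_Icc hc0 hc1 ω) (g₂.eval_mem_Icc hc0 hc1 ω)
  | max g₁ g₂ => exact max_mem_Icc (g₁.eval_mem_Icc hc0 hc1 ω) (g₂.eval_mem_Icc hc0 hc1 ω)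
  | tsub g q => exact max_zero_sub_mem_Icc (g.eval_mem_Icc hc0 hc1 ω).2 (ratCast_mem_Icc q).1
  | tadd g q => exact min_one_add_mem_Icc (g.eval_mem_Icc hc0 hc1 ω).1 (ratCast_mem_Icc q).1

end

theorem StateFormula.le_ellDist (f : StateFormula) (x y : E) :
    ENNReal.ofReal |f.eval D obs c x - f.eval D obs c y| ≤ ellDist D obs c x y :=
  le_iSup (fun f : StateFormula => ENNReal.ofReal |f.eval D obs c x - f.eval D obs c y|) f

/-- Discounted evaluation negates to `1 - c ^ t * f = c ^ t * (1 - f) + (1 - c ^ t)`, whose second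
summand may be irrational: hence closure under negation only up to uniform approximation. -/
theorem TrajFormula.compl_mem_uniformClosure (hc0 : 0 ≤ c) (hc1 : c ≤ 1) (g : TrajFormula) :
    (fun ω => 1 - g.eval D obs c ω) ∈ uniformClosure fun g : TrajFormula => g.eval D obs c := by
  intro ε hε
  cases g with simp only [TrajFormula.eval]
  | ev f t =>
    have h_rpow := rpow_nnratCast_mem_Icc hc0 hc1 t
    obtain ⟨q, hq⟩ := exists_rat_mem_Icc_abs_sub_le (Set.Icc.one_sub_mem h_rpow) hε
    refine ⟨.tadd (.ev (.compl f) t) q, fun ω => ?_⟩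
    have h_ev := unitInterval.mul_mem h_rpow (f.eval_mem_Icc D obs hc0 hc1 (ω (t : ℝ≥0)))
    simp only [TrajFormula.eval, StateFormula.eval]
    rw [Set.mem_Icc] at h_ev
    rw [abs_le] at hq ⊢
    rw [mul_sub, mul_one]
    grind
  | min g₁ g₂ =>
    obtain ⟨k₁, h₁⟩ := g₁.compl_mem_uniformClosure hc0 hc1 ε hε
    obtain ⟨k₂, h₂⟩ := g₂.compl_mem_uniformClosure hc0 hc1 ε hε
    refine ⟨.max k₁ k₂, fun ω => ?_⟩
    simp only [TrajFormula.eval]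
    rw [← max_sub_sub_left]
    exact (abs_max_sub_max_le_max _ _ _ _).trans (max_le (h₁ ω) (h₂ ω))
  | max g₁ g₂ =>
    obtain ⟨k₁, h₁⟩ := g₁.compl_mem_uniformClosure hc0 hc1 ε hε
    obtain ⟨k₂, h₂⟩ := g₂.compl_mem_uniformClosure hc0 hc1 ε hε
    refine ⟨.min k₁ k₂, fun ω => ?_⟩
    simp only [TrajFormula.eval]
    rw [← min_sub_sub_left]
    exact (abs_min_sub_min_le_max _ _ _ _).trans (max_le (h₁ ω) (h₂ ω))
  | tsub g q =>
    obtain ⟨k, hk⟩ := g.compl_mem_uniformClosure hc0 hc1 ε hε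
    refine ⟨.tadd k q, fun ω => ?_⟩
    simp only [TrajFormula.eval]
    rw [← min_sub_sub_left, sub_zero, ← sub_add]
    exact (abs_min_one_add_sub_le _ _ _).trans (hk ω)
  | tadd g q =>
    obtain ⟨k, hk⟩ := g.compl_mem_uniformClosure hc0 hc1 ε hε
    refine ⟨.tsub k q, fun ω => ?_⟩
    simp only [TrajFormula.eval]
    rw [← max_sub_sub_left, sub_self, ← sub_sub]
    exact (abs_max_zero_sub_sub_le _ _ _).trans (hk ω)

theorem TrajFormula.isApproxLattice_eval (hc0 : 0 ≤ c) (hc1 : c ≤ 1) :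
    IsApproxLattice fun g : TrajFormula => g.eval D obs c where
  mem_Icc := TrajFormula.eval_mem_Icc D obs hc0 hc1
  inf_mem g₁ g₂ := by
    simpa only [TrajFormula.eval] using
      self_mem_uniformClosure (fun g : TrajFormula => g.eval D obs c) (TrajFormula.min g₁ g₂)
  compl_mem := TrajFormula.compl_mem_uniformClosure D obs hc0 hc1
  tsub_mem g q := by
    simpa only [TrajFormula.eval] using
      self_mem_uniformClosure (fun g : TrajFormula => g.eval D obs c) (TrajFormula.tsub g q)

mutual

theorem StateFormula.continuous_eval [SequentialSpace E] (hc0 : 0 ≤ c) (hc1 : c ≤ 1)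
    (f : StateFormula) :
    Continuous (f.eval D obs c) := by
  cases f with simp only [StateFormula.eval]
  | const q => exact continuous_const
  | obs => exact continuous_subtype_val.comp obs.continuous
  | compl f => exact continuous_const.sub (f.continuous_eval hc0 hc1)
  | integral g =>
    exact D.continuous_integral_law (g.continuous_eval hc0 hc1) (g.eval_mem_Icc D obs hc0 hc1)

theorem TrajFormula.continuous_eval [SequentialSpace E] (hc0 : 0 ≤ c) (hc1 : c ≤ 1)
    (g : TrajFormula) :
    Continuous (g.eval D obs c) := by
  cases g with simp only [TrajFormula.eval]
  | ev f t =>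
    exact continuous_const.mul ((f.continuous_eval hc0 hc1).comp (continuous_eval_const _))
  | min g₁ g₂ => exact (g₁.continuous_eval hc0 hc1).min (g₂.continuous_eval hc0 hc1)
  | max g₁ g₂ => exact (g₁.continuous_eval hc0 hc1).max (g₂.continuous_eval hc0 hc1)
  | tsub g q => exact continuous_const.max ((g.continuous_eval hc0 hc1).sub continuous_const)
  | tadd g q => exact continuous_const.min ((g.continuous_eval hc0 hc1).add continuous_const)

end

theorem discountedUniform_ellDist_le [SequentialSpace E] (hc0 : 0 < c) (hc1 : c ≤ 1)
    (ω ω' : Trajectory E) :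
    discountedUniform c (ellDist D obs c) ω ω' ≤
      ⨆ g : TrajFormula, ENNReal.ofReal |g.eval D obs c ω - g.eval D obs c ω'| := by
  refine iSup_le fun t => ?_
  rw [ellDist, ENNReal.mul_iSup]
  refine iSup_le fun f => ?_
  have hf := f.continuous_eval D obs hc0.le hc1
  have h_rat (q : ℚ≥0) :
      ENNReal.ofReal |c ^ (q : ℝ) * f.eval D obs c (ω (q : ℝ≥0)) -
        c ^ (q : ℝ) * f.eval D obs c (ω' (q : ℝ≥0))| ≤
      ⨆ g : TrajFormula, ENNReal.ofReal |g.eval D obs c ω - g.eval D obs c ω'| := by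
    simpa only [TrajFormula.eval] using
      le_iSup (fun g : TrajFormula => ENNReal.ofReal |g.eval D obs c ω - g.eval D obs c ω'|)
        (TrajFormula.ev f q)
  exact ofReal_rpow_mul_le_of_rat hc0 (hf.comp ω.continuous) (hf.comp ω'.continuous) h_rat t

theorem TrajFormula.measurable_eval [BorelSpace E] [SecondCountableTopology E]
    (hc0 : 0 ≤ c) (hc1 : c ≤ 1) (g : TrajFormula) :
    Measurable (g.eval D obs c) := by
  cases g with simp only [TrajFormula.eval]
  | ev f t =>
    exact ((f.continuous_eval D obs hc0 hc1).measurable.comp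
      (measurable_trajectory_apply E _)).const_mul _
  | min g₁ g₂ => exact (g₁.measurable_eval hc0 hc1).min (g₂.measurable_eval hc0 hc1)
  | max g₁ g₂ => exact (g₁.measurable_eval hc0 hc1).max (g₂.measurable_eval hc0 hc1)
  | tsub g q => exact measurable_const.max ((g.measurable_eval hc0 hc1).sub_const _)
  | tadd g q => exact measurable_const.min ((g.measurable_eval hc0 hc1).add_const _)

mutual

theorem StateFormula.nonexpansiveForSome_dSeq
    [BorelSpace E] [SecondCountableTopology E] [MeasurableSingletonClass E]
    (hc0 : 0 ≤ c) (hc1 : c ≤ 1) (f : StateFormula) :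
    NonexpansiveForSome (dSeq D obs c) (f.eval D obs c) := by
  cases f with simp only [StateFormula.eval]
  | const q => exact .const _
  | obs => exact ⟨0, fun x y => le_rfl⟩
  | compl f => exact (f.nonexpansiveForSome_dSeq hc0 hc1).one_sub
  | integral g =>
    obtain ⟨n, hn⟩ := g.nonexpansiveForSome_discountedUniform_dSeq hc0 hc1
    have hg := g.measurable_eval D obs hc0 hc1
    have hg_int (ρ : Measure (Trajectory E)) [IsProbabilityMeasure ρ] :
        Integrable (g.eval D obs c) ρ :=
      .of_mem_Icc 0 1 hg.aemeasurable (ae_of_all _ (g.eval_mem_Icc D obs hc0 hc1))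
    exact ⟨n + 1, fun x y =>
      ofReal_abs_integral_sub_le_transport hg (hg_int _) (hg_int _) hn⟩

theorem TrajFormula.nonexpansiveForSome_discountedUniform_dSeq
    [BorelSpace E] [SecondCountableTopology E] [MeasurableSingletonClass E]
    (hc0 : 0 ≤ c) (hc1 : c ≤ 1) (g : TrajFormula) :
    NonexpansiveForSome (fun n => discountedUniform c (dSeq D obs c n)) (g.eval D obs c) := by
  have h_mono : Monotone fun n => discountedUniform c (dSeq D obs c n) :=
    discountedUniform_mono.comp (dSeq_monotone D obs)
  cases g with simp only [TrajFormula.eval]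
  | ev f t =>
    obtain ⟨n, hn⟩ := f.nonexpansiveForSome_dSeq hc0 hc1
    refine ⟨n, fun ω ω' => ?_⟩
    rw [← ofReal_rpow_mul hc0, ← coe_nnratCast_nnreal]
    exact (mul_le_mul_right (hn _ _) _).trans (le_discountedUniform _ ω ω' (t : ℝ≥0))
  | min g₁ g₂ =>
    exact .min h_mono (g₁.nonexpansiveForSome_discountedUniform_dSeq hc0 hc1)
      (g₂.nonexpansiveForSome_discountedUniform_dSeq hc0 hc1)
  | max g₁ g₂ =>
    exact .max h_mono (g₁.nonexpansiveForSome_discountedUniform_dSeq hc0 hc1)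
      (g₂.nonexpansiveForSome_discountedUniform_dSeq hc0 hc1)
  | tsub g q => exact (g.nonexpansiveForSome_discountedUniform_dSeq hc0 hc1).tsub q
  | tadd g q => exact (g.nonexpansiveForSome_discountedUniform_dSeq hc0 hc1).tadd q

end

variable [BorelSpace E] [LocallyCompactSpace E] [T2Space E] [SecondCountableTopology E]

theorem trajFunctional_ellDist_le (hc0 : 0 < c) (hc1 : c ≤ 1) :
    trajFunctional D c (ellDist D obs c) ≤ ellDist D obs c := by
  have := polishSpace_of_locallyCompactSpace E
  have := standardBorelSpace_trajectory E
  intro x y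
  calc trajFunctional D c (ellDist D obs c) x y
      ≤ transport (fun ω ω' => ⨆ g : TrajFormula,
          ENNReal.ofReal |g.eval D obs c ω - g.eval D obs c ω'|) (D.law x) (D.law y) :=
        transport_mono (discountedUniform_ellDist_le D obs hc0 hc1) _ _
    _ ≤ ⨆ g : TrajFormula, ENNReal.ofReal
          |∫ ω, g.eval D obs c ω ∂(D.law x) - ∫ ω, g.eval D obs c ω ∂(D.law y)| :=
        (TrajFormula.isApproxLattice_eval D obs hc0.le hc1).transport_iSup_le
          (TrajFormula.measurable_eval D obs hc0.le hc1)
    _ ≤ ellDist D obs c x y := iSup_le fun g => by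
        simpa only [StateFormula.eval] using (StateFormula.integral g).le_ellDist D obs x y

theorem dSeq_le_ellDist (hc0 : 0 < c) (hc1 : c ≤ 1) (n : ℕ) :
    dSeq D obs c n ≤ ellDist D obs c := by
  induction n with
  | zero =>
    intro x y
    have h_obs := StateFormula.obs.le_ellDist D obs (c := c) x y
    simp only [StateFormula.eval] at h_obs
    exact h_obs
  | succ n ih =>
    exact (trajFunctional_mono D ih).trans (trajFunctional_ellDist_le D obs hc0 hc1)

theorem dBar_eq_ellDist (hc0 : 0 < c) (hc1 : c ≤ 1) : dBar D obs c = ellDist D obs c := by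
  refine le_antisymm (fun x y => iSup_le fun n => dSeq_le_ellDist D obs hc0 hc1 n x y)
    fun x y => iSup_le fun f => ?_
  obtain ⟨n, hn⟩ := f.nonexpansiveForSome_dSeq D obs hc0.le hc1
  exact le_iSup_of_le n (hn x y)

end TrajectoryLogic

theorem mainTheorem5_general {E : Type*} [TopologicalSpace E] [LocallyCompactSpace E] [T2Space E]
    [SecondCountableTopology E] [MeasurableSpace E] [BorelSpace E]
    (D : Diffusion E) (obs : C(E, unitInterval)) (c : ℝ) (hc0 : 0 < c) (hc1 : c ≤ 1) :
    lambdaDist D obs c = deltaBar D obs c ∧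
      deltaBar D obs c ≤ dBar D obs c ∧
      dBar D obs c = ellDist D obs c :=
  ⟨lambdaDist_eq_deltaBar D obs hc0 hc1, deltaBar_le_dBar D obs,
    dBar_eq_ellDist D obs hc0 hc1⟩

end FellerDynkin

theorem mainTheorem5 {E : Type*} [TopologicalSpace E] [LocallyCompactSpace E] [T2Space E]
    [SecondCountableTopology E] [MeasurableSpace E] [BorelSpace E]
    (D : Diffusion E) (obs : C(E, unitInterval)) (c : ℝ) (hc0 : 0 < c) (hc1 : c < 1) :
    lambdaDist D obs c = deltaBar D obs c ∧
      deltaBar D obs c ≤ dBar D obs c ∧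
      dBar D obs c = ellDist D obs c :=
  mainTheorem5_general D obs c hc0 hc1.le
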